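/- **Setting.** Let $n\ge 1$ and let $U$ be a set of $2n$ offline vertices. Online vertices arrive one by one; when $v$ arrives, its neighbourhood $N(v)\subseteq U$ and its advice $A(v)\in N(v)\cup\{\bot\}$ are revealed. An *algorithm* $\mathcal M$ (deterministic, online, fractional) then chooses irrevocably, as a function of what has been revealed so far, amounts $x_{u,v}\ge 0$ for $u\in N(v)$, with $\sum_{u\in N(v)}x_{u,v}\le 1$ and such that the *level* of each $u\in U$ (the total amount that $u$ has received so far) never exceeds $1$. The value of its output is $\sum_{u,v}x_{u,v}$. A vertex is *saturated* if the total amount on its edges is $1$. **Adversaries.** The adaptive adversaries $\mathcal R$ and $\mathcal C$ start from an ordering $u_1,\dots,u_{2n}$ of $U$ and change the indices as the run proceeds. - *Common phase (both).* For $t=1,\dots,n$: present $v_t$ with $N(v_t)=\{u_t,\dots,u_{2n-t+1}\}$ and $A(v_t)=u_t$; after the response of $\mathcal M$, reorder $u_{t+1},\dots,u_{2n-t+1}$ so that their current levels are nonincreasing. - *Robustness phase ($\mathcal R$ only).* Reorder $u_1,\dots,u_n$ so that their levels are nondecreasing. For $t=n+1,\dots,2n$: present $v_t$ with $N(v_t)=\{u_{t-n},\dots,u_n\}$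 and $A(v_t)=\bot$; after the response of $\mathcal M$, reorder $u_{t-n},\dots,u_n$ so that their levels are nondecreasing. - *Consistency phase ($\mathcal C$ only).* For $t=n+1,\dots,2n$: present $v_t$ with $N(v_t)=\{u_t\}$ and $A(v_t)=u_t$. If the vertices to be reordered are already in the required order, nothing is moved; otherwise ties are broken by an arbitrary fixed rule, which may depend on the history and is the same for both adversaries in the common phase. Let $\mathcal M(\mathcal R)$ and $\mathcal M(\mathcal C)$ denote the values of the outputs of $\mathcal M$ against $\mathcal R$ and $\mathcal C$. **Lemma.** For every algorithm $\mathcal M$ there is an algorithm $\overline{\mathcal M}$ such that 1. (Greediness) $\overline{\mathcal M}$ saturates each online vertex unless all the neighbours of that vertex are saturated; 2. (Monotonicity) $\overline{\mathcal M}$ never makes $\mathcal R$ or $\mathcal C$ change the order of the offline vertices; 3. (Uniformity) against $\mathcal R$ and $\mathcal C$, for each $t\in\{1,\dots,n\}$, $\overline{\mathcal M}$ sends the same amount from $v_t$ to all $u\in N(v_t)$ with $u\ne A(v_t)$; 4. $\overline{\mathcal M}(\mathcal R)\ge\mathcal M(\mathcal R)$ and $\overline{\mathcal M}(\mathcal C)\ge\mathcal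 M(\mathcal C)$. -/

import Mathlib

/-- What is revealed when an online vertex arrives: its neighbourhood among the offline vertices
`U`, and the advised offline vertex (`none` stands for `⊥`, no advice). -/
structure Arrival (U : Type) where
  nbrs : Finset U
  advice : Option U

/-- The level of the offline vertex `u` after the arrivals in the list (most recent first), if
`push past a u` is the amount sent to `u` by the arrival `a` that comes after `past`. -/
noncomputable def levelOf {U : Type} (push : List (Arrival U) → Arrival U → U → ℝ) :
    List (Arrival U) → U → ℝ
  | [], _ => 0
  | a :: past, u => levelOf push past u + push past a u

/-- A (deterministic) online fractional matching algorithm with offline vertices `U`.  On the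
arrival `a`, after the arrivals `past` (most recent first), it irrevocably sends `push past a u`
units of water along the edge between `u` and the arriving vertex. -/
structure FractionalAlgorithm (U : Type) where
  push : List (Arrival U) → Arrival U → U → ℝ
  push_nonneg : ∀ past a u, 0 ≤ push past a u
  push_eq_zero : ∀ past a u, u ∉ a.nbrs → push past a u = 0
  sum_push_le_one : ∀ past a, ∑ u ∈ a.nbrs, push past a u ≤ 1
  level_le_one : ∀ past u, levelOf push past u ≤ 1

namespace FractionalAlgorithm

variable {U : Type}

/-- The level of `u` after the given arrivals (most recent first). -/
noncomputable def level (M : FractionalAlgorithm U) (past : List (Arrival U)) (u : U) : ℝ :=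
  levelOf M.push past u

/-- The size `∑ x_{u,v}` of the fractional matching that `M` outputs on the given arrivals. -/
noncomputable def value (M : FractionalAlgorithm U) : List (Arrival U) → ℝ
  | [] => 0
  | a :: past => M.value past + ∑ u ∈ a.nbrs, M.push past a u

/-- Greediness: on every input, each online vertex is saturated unless all its neighbours are. -/
def Greedy (M : FractionalAlgorithm U) : Prop :=
  ∀ past a, ∑ u ∈ a.nbrs, M.push past a u = 1 ∨ ∀ u ∈ a.nbrs, M.level (a :: past) u = 1

end FractionalAlgorithm

/-- How an adversary reorders.  An ordering `σ` says that the vertex `σ i` currently is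
`u_{i+1}`.  `reorder past key B σ` permutes only the vertices at the indices in `B`, so that `key`
becomes nondecreasing along `B`.  Ties are broken in an arbitrary way, which may depend on the
whole history `past`, but nothing is moved if `key` is nondecreasing along `B` already. -/
structure ReorderRule (n : ℕ) where
  reorder : List (Arrival (Fin (2 * n))) → (Fin (2 * n) → ℝ) → Finset (Fin (2 * n)) →
    Equiv.Perm (Fin (2 * n)) → Equiv.Perm (Fin (2 * n))
  fixed : ∀ past key (B : Finset (Fin (2 * n))) σ, ∀ i ∉ B, reorder past key B σ i = σ i
  sorted : ∀ past (key : Fin (2 * n) → ℝ) (B : Finset (Fin (2 * n))) σ,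
    MonotoneOn (fun i => key (reorder past key B σ i)) (B : Set (Fin (2 * n)))
  of_sorted : ∀ past (key : Fin (2 * n) → ℝ) (B : Finset (Fin (2 * n)))
    (σ : Equiv.Perm (Fin (2 * n))),
    MonotoneOn (fun i => key (σ i)) (B : Set (Fin (2 * n))) → reorder past key B σ = σ

/-- The state of an adversary: the current ordering of the offline vertices, and the vertices
presented so far (most recent first). -/
structure AdversaryState (n : ℕ) where
  order : Equiv.Perm (Fin (2 * n))
  past : List (Arrival (Fin (2 * n)))

/- Indices and rounds are counted from `0`: the index `j` below is the index `j + 1` of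
`u_1, …, u_{2n}`.  In the common phase, `s` stands for iteration `t = s + 1`; in the other two
phases, `k` stands for iteration `t = n + k + 1`. -/

/-- The vertex `v_{s+1}` of the common phase: its neighbours are `u_{s+1}, …, u_{2n-s}`, and its
advice is `u_{s+1}`. -/
def commonArrival (n s : ℕ) (σ : Equiv.Perm (Fin (2 * n))) : Arrival (Fin (2 * n)) where
  nbrs := (Finset.univ.filter fun j : Fin (2 * n) => s ≤ j.val ∧ j.val + s < 2 * n).image σ
  advice := if h : s < 2 * n then some (σ ⟨s, h⟩) else none

/-- The indices `s+2, …, 2n-s` that are sorted at the end of iteration `s + 1`. -/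
def commonBlock (n s : ℕ) : Finset (Fin (2 * n)) :=
  Finset.univ.filter fun j => s + 1 ≤ j.val ∧ j.val + s < 2 * n

/-- The vertex `v_{n+k+1}` of the robustness phase: its neighbours are `u_{k+1}, …, u_n`, and it
has no advice. -/
def robustArrival (n k : ℕ) (σ : Equiv.Perm (Fin (2 * n))) : Arrival (Fin (2 * n)) where
  nbrs := (Finset.univ.filter fun j : Fin (2 * n) => k ≤ j.val ∧ j.val < n).image σ
  advice := none

/-- The indices `k+1, …, n` that are sorted at the end of iteration `n + k + 1` of the robustness
phase; for `k = 0`, also those that are sorted just before the robustness phase. -/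
def robustBlock (n k : ℕ) : Finset (Fin (2 * n)) :=
  Finset.univ.filter fun j => k ≤ j.val ∧ j.val < n

/-- The vertex `v_{n+k+1}` of the consistency phase: its only neighbour and its advice are
`u_{n+k+1}`. -/
def consistencyArrival (n k : ℕ) (σ : Equiv.Perm (Fin (2 * n))) : Arrival (Fin (2 * n)) where
  nbrs := (Finset.univ.filter fun j : Fin (2 * n) => j.val = n + k).image σ
  advice := if h : n + k < 2 * n then some (σ ⟨n + k, h⟩) else none

section Adversaries

variable {n : ℕ}

/-- The state of both adversaries after `s` iterations of the common phase.  Each iteration ends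
with sorting `u_{s+2}, …, u_{2n-s}` by nonincreasing level. -/
noncomputable def commonState (ρ : ReorderRule n) (M : FractionalAlgorithm (Fin (2 * n))) :
    ℕ → AdversaryState n
  | 0 => ⟨Equiv.refl _, []⟩
  | s + 1 =>
    let S := commonState ρ M s
    let past := commonArrival n s S.order :: S.past
    ⟨ρ.reorder past (fun u => - M.level past u) (commonBlock n s) S.order, past⟩

/-- The state of the robustness adversary after the common phase, the sorting of `u_1, …, u_n` by
nondecreasing level, and `k` iterations of the robustness phase.  Each of these ends with sorting
`u_{k+1}, …, u_n` by nondecreasing level. -/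
noncomputable def robustState (ρ : ReorderRule n) (M : FractionalAlgorithm (Fin (2 * n))) :
    ℕ → AdversaryState n
  | 0 =>
    let S := commonState ρ M n
    ⟨ρ.reorder S.past (fun u => M.level S.past u) (robustBlock n 0) S.order, S.past⟩
  | k + 1 =>
    let S := robustState ρ M k
    let past := robustArrival n k S.order :: S.past
    ⟨ρ.reorder past (fun u => M.level past u) (robustBlock n k) S.order, past⟩

/-- The state of the consistency adversary after the common phase and `k` iterations of the
consistency phase. -/
noncomputable def consistencyState (ρ : ReorderRule n) (M : FractionalAlgorithm (Fin (2 * n))) :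
    ℕ → AdversaryState n
  | 0 => commonState ρ M n
  | k + 1 =>
    let S := consistencyState ρ M k
    ⟨S.order, consistencyArrival n k S.order :: S.past⟩

/-- The size of the output of `M` against the robustness adversary. -/
noncomputable def robustValue (ρ : ReorderRule n) (M : FractionalAlgorithm (Fin (2 * n))) : ℝ :=
  M.value (robustState ρ M n).past

/-- The size of the output of `M` against the consistency adversary. -/
noncomputable def consistencyValue (ρ : ReorderRule n) (M : FractionalAlgorithm (Fin (2 * n))) :
    ℝ :=
  M.value (consistencyState ρ M n).past

/-- Monotonicity: `M` never makes the adversaries reorder, be it in the common phase, just before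
the robustness phase or during it.  (There is no reordering in the consistency phase.) -/
def NeverReorders (ρ : ReorderRule n) (M : FractionalAlgorithm (Fin (2 * n))) : Prop :=
  (∀ s < n, (commonState ρ M (s + 1)).order = (commonState ρ M s).order) ∧
  (robustState ρ M 0).order = (commonState ρ M n).order ∧
  (∀ k < n, (robustState ρ M (k + 1)).order = (robustState ρ M k).order)

/-- Uniformity: in each iteration of the common phase, `M` sends the same amount to all the
neighbours other than the advised one. -/
def UniformInCommonPhase (ρ : ReorderRule n) (M : FractionalAlgorithm (Fin (2 * n))) : Prop :=
  ∀ s < n,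
    let S := commonState ρ M s
    let a := commonArrival n s S.order
    ∀ u ∈ a.nbrs, ∀ w ∈ a.nbrs, a.advice ≠ some u → a.advice ≠ some w →
      M.push S.past a u = M.push S.past a w

end Adversaries

/-- One uniform step: of `m + 1` vertices at level `x`, one is raised to `max a x`, and the rest of
one unit is split evenly among the other `m` vertices (which are capped at `1`).  The value is the
resulting level of these `m` vertices. -/
noncomputable def stepLevel (m x a : ℝ) : ℝ := min 1 (((m + 1) * x + 1 - max a x) / m)

/-- The sum of the levels reached in consecutive uniform steps with targets `l`, starting from `x`,
if two vertices are left out after each step and one vertex remains unadvised in the last one. -/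
noncomputable def totalLevel : List ℝ → ℝ → ℝ
  | [], _ => 0
  | a :: l, x =>
    stepLevel (2 * l.length + 1) x a + totalLevel l (stepLevel (2 * l.length + 1) x a)

section UniformSteps

variable {m x x' a b : ℝ}

theorem stepLevel_le_one : stepLevel m x a ≤ 1 := min_le_left _ _

theorem mul_stepLevel_le (hm : 1 ≤ m) : m * stepLevel m x a ≤ (m + 1) * x + 1 - max a x := by
  have h : stepLevel m x a ≤ ((m + 1) * x + 1 - max a x) / m := min_le_right _ _
  rw [le_div_iff₀ (by linarith)] at h
  linarith

theorem stepLevel_eq_one_or (hm : 1 ≤ m) :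
    stepLevel m x a = 1 ∨ m * stepLevel m x a = (m + 1) * x + 1 - max a x := by
  unfold stepLevel
  rcases min_choice 1 (((m + 1) * x + 1 - max a x) / m) with h | h
  · exact Or.inl h
  · right
    rw [h]
    field_simp

theorem le_stepLevel {y : ℝ} (hm : 1 ≤ m) (h1 : y ≤ 1) (h : m * y ≤ (m + 1) * x + 1 - max a x) :
    y ≤ stepLevel m x a := by
  refine le_min h1 ?_
  rw [le_div_iff₀ (by linarith)]
  linarith

theorem self_le_stepLevel (hm : 1 ≤ m) (hx : 0 ≤ x) (hx1 : x ≤ 1) (ha : a ≤ 1) :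
    x ≤ stepLevel m x a := by
  refine le_stepLevel hm hx1 ?_
  rcases max_choice a x with h | h <;> rw [h] <;> linarith

theorem stepLevel_mono (hm : 1 ≤ m) (h : x ≤ x') : stepLevel m x a ≤ stepLevel m x' a := by
  refine le_stepLevel hm stepLevel_le_one ((mul_stepLevel_le hm).trans ?_)
  have : max a x' ≤ max a x + (x' - x) := max_le (by linarith [le_max_left a x])
    (by linarith [le_max_right a x])
  nlinarith

theorem stepLevel_antitone (hm : 1 ≤ m) (h : b ≤ a) : stepLevel m x a ≤ stepLevel m x b := by
  refine le_stepLevel hm stepLevel_le_one ((mul_stepLevel_le hm).trans ?_)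
  linarith [max_le_max_right x h]

/-- Conservation of water: extra level on `m + 1` vertices is at most all passed on to the `m`
unadvised ones. The cap and a larger `max a x'` only reduce the gain. -/
theorem mul_stepLevel_sub_le (hm : 1 ≤ m) (h : x ≤ x') :
    m * (stepLevel m x' a - stepLevel m x a) ≤ (m + 1) * (x' - x) := by
  have h1 := mul_stepLevel_le (x := x') (a := a) hm
  have h0 : 0 ≤ (m + 1) * (x' - x) := mul_nonneg (by linarith) (by linarith)
  rcases stepLevel_eq_one_or (x := x) (a := a) hm with h2 | h2
  · have : stepLevel m x' a ≤ 1 := stepLevel_le_one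
    rw [h2]
    nlinarith
  · have := max_le_max_left a h
    linarith

theorem one_le_two_mul_length_add_one (l : List ℝ) : (1 : ℝ) ≤ 2 * l.length + 1 := by
  have : (0 : ℝ) ≤ l.length := Nat.cast_nonneg _
  linarith

theorem totalLevel_mono (l : List ℝ) : Monotone (totalLevel l) := by
  induction l with
  | nil => exact fun _ _ _ => le_rfl
  | cons a l ih =>
    intro x x' h
    have := stepLevel_mono (a := a) (one_le_two_mul_length_add_one l) h
    exact add_le_add this (ih this)

/-- The extra water is `2 * l.length * (x' - x)`, and what is left behind cannot gain more than
that. In the induction, a gain `δ` in the first step contributes `δ` itself and at most `2rδ` later,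
and `(2r + 1)δ` is bounded by `mul_stepLevel_sub_le`. -/
theorem totalLevel_sub_le (l : List ℝ) (h : x ≤ x') :
    totalLevel l x' - totalLevel l x ≤ 2 * l.length * (x' - x) := by
  induction l generalizing x x' with
  | nil => simp [totalLevel]
  | cons a l ih =>
    have hm := one_le_two_mul_length_add_one l
    have h1 := stepLevel_mono (a := a) hm h
    have h2 := mul_stepLevel_sub_le (a := a) hm h
    have h3 := ih h1
    simp only [totalLevel, List.length_cons, Nat.cast_add, Nat.cast_one]
    linarith

/-- Serving the smaller target first leaves more on the vertex dropped after the first step (`y ≤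
y'`). If the level after both steps becomes lower (`z' < z`), the loss, now and in all later steps,
is at most `m * (z - z')` by the Lipschitz bound, and conservation of water gives `m * (z - z') ≤ y'
- y`. -/
theorem totalLevel_swap (l : List ℝ) (hx : 0 ≤ x) (hx1 : x ≤ 1) (hab : b ≤ a) (ha : a ≤ 1) :
    totalLevel (a :: b :: l) x ≤ totalLevel (b :: a :: l) x := by
  have hm := one_le_two_mul_length_add_one l
  simp only [totalLevel, List.length_cons, Nat.cast_add, Nat.cast_one]
  set m : ℝ := 2 * l.length + 1 with hmdef
  have hm2 : 2 * ((l.length : ℝ) + 1) + 1 = m + 2 := by rw [hmdef]; ring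
  rw [hm2]
  have hm' : 1 ≤ m + 2 := by linarith
  set y := stepLevel (m + 2) x a with hy
  set y' := stepLevel (m + 2) x b with hy'
  set z := stepLevel m y b with hz
  set z' := stepLevel m y' a with hz'
  have hyy : y ≤ y' := stepLevel_antitone hm' hab
  have hxy : x ≤ y := self_le_stepLevel hm' hx hx1 ha
  have hy1 : y' ≤ 1 := stepLevel_le_one
  rcases le_or_gt z z' with h | h
  · have := totalLevel_mono l h
    linarith
  have hz1 : z ≤ 1 := stepLevel_le_one
  have e1 : m * z' = (m + 1) * y' + 1 - max a y' := by
    rcases stepLevel_eq_one_or (x := y') (a := a) hm with h2 | h2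
    · exact absurd h2 (by linarith)
    · exact h2
  have e2 : m * z ≤ (m + 1) * y + 1 - max b y := mul_stepLevel_le hm
  have hzz : m * z' < m * z := mul_lt_mul_of_pos_left h (by linarith)
  -- Otherwise the late target `a` costs nothing beyond the common level, so `m * z' = m * y' + 1 ≥
  -- m * y + 1 ≥ m * z`. With `a ≤ 1` this also shows that `y'` is not capped.
  have hay : y' < a := by
    by_contra hc
    rw [max_eq_right (not_lt.1 hc)] at e1
    have := le_max_right b y
    nlinarith
  have e3 : (m + 2) * y' = (m + 2 + 1) * x + 1 - max b x := by
    rcases stepLevel_eq_one_or (x := x) (a := b) hm' with h2 | h2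
    · exact absurd h2 (by linarith)
    · exact h2
  have e4 : (m + 2) * y ≤ (m + 2 + 1) * x + 1 - max a x := mul_stepLevel_le hm'
  rw [max_eq_left hay.le] at e1
  rw [max_eq_left (by linarith : x ≤ a)] at e4
  have := max_le_max_left b hxy
  have := totalLevel_sub_le l h.le
  linarith

theorem totalLevel_le_orderedInsert (l : List ℝ) (hx : 0 ≤ x) (hx1 : x ≤ 1) (ha : a ≤ 1)
    (hl : ∀ c ∈ l, c ≤ 1) :
    totalLevel (a :: l) x ≤ totalLevel (l.orderedInsert (· ≤ ·) a) x := by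
  induction l generalizing x with
  | nil => exact le_rfl
  | cons b l ih =>
    rw [List.orderedInsert_cons]
    split_ifs with h
    · exact le_rfl
    · refine (totalLevel_swap l hx hx1 (not_le.1 h).le ha).trans ?_
      have hb : b ≤ 1 := hl b (by simp)
      have hm := one_le_two_mul_length_add_one (a :: l)
      have e : ∀ l', totalLevel (b :: l') x = stepLevel (2 * l'.length + 1) x b +
        totalLevel l' (stepLevel (2 * l'.length + 1) x b) := fun _ => rfl
      rw [e, e, List.orderedInsert_length, ← List.length_cons (a := a)]
      gcongr
      exact ih (hx.trans (self_le_stepLevel hm hx hx1 hb)) stepLevel_le_one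
        (fun c hc => hl c (by simp [hc]))

theorem totalLevel_le_insertionSort (l : List ℝ) (hx : 0 ≤ x) (hx1 : x ≤ 1)
    (hl : ∀ c ∈ l, c ≤ 1) : totalLevel l x ≤ totalLevel (l.insertionSort (· ≤ ·)) x := by
  induction l generalizing x with
  | nil => exact le_rfl
  | cons a l ih =>
    have ha : a ≤ 1 := hl a (by simp)
    have hl' : ∀ c ∈ l, c ≤ 1 := fun c hc => hl c (by simp [hc])
    have hm := one_le_two_mul_length_add_one l
    refine le_trans ?_ (totalLevel_le_orderedInsert (l.insertionSort (· ≤ ·)) hx hx1 ha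
      (fun c hc => hl' c ((List.mem_insertionSort _).1 hc)))
    rw [totalLevel, totalLevel, List.length_insertionSort]
    gcongr
    exact ih (hx.trans (self_le_stepLevel hm hx hx1 ha)) stepLevel_le_one hl'

theorem totalLevel_le_of_perm_of_sorted {l l' : List ℝ} (hx : 0 ≤ x) (hx1 : x ≤ 1)
    (hl : ∀ c ∈ l, c ≤ 1) (hp : l.Perm l') (hs : l'.Pairwise (· ≤ ·)) :
    totalLevel l x ≤ totalLevel l' x := by
  have : l.insertionSort (· ≤ ·) = l' :=
    ((List.perm_insertionSort _ l).trans hp).eq_of_pairwise' (List.pairwise_insertionSort _ _) hs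
  rw [← this]
  exact totalLevel_le_insertionSort l hx hx1 hl

/-- The total `∑ d s` of the smallest levels that are left out is at most what uniform steps
achieve, if `ℓ s` is the final level of the advised vertex, and `T s` is the total level of the
remaining vertices. -/
theorem sum_le_totalLevel (r : ℕ) (ℓ d T : ℕ → ℝ)
    (hw : ∀ s < r, T (s + 1) + d s + ℓ s ≤ T s + 1)
    (hd : ∀ s < r, d s * (2 * ((r : ℝ) - s) - 2) ≤ T (s + 1))
    (hl : ∀ s < r, T s ≤ 2 * ((r : ℝ) - s) * ℓ s)
    (h1 : ∀ s < r, T (s + 1) + d s ≤ 2 * ((r : ℝ) - s) - 1)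
    (hT : T r = 0) :
    ∑ s ∈ Finset.range r, d s ≤ totalLevel ((List.range r).map ℓ) (T 0 / (2 * r)) := by
  induction r generalizing ℓ d T with
  | zero => simp [totalLevel]
  | succ r ih =>
    have ih' := ih (fun s => ℓ (s + 1)) (fun s => d (s + 1)) (fun s => T (s + 1))
      (fun s hs => hw (s + 1) (by omega))
      (fun s hs => by have := hd (s + 1) (by omega); push_cast at this; ring_nf at this ⊢; exact this)
      (fun s hs => by have := hl (s + 1) (by omega); push_cast at this; ring_nf at this ⊢; exact this)
      (fun s hs => by have := h1 (s + 1) (by omega); push_cast at this; ring_nf at this ⊢; exact this)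
      hT
    have hw0 := hw 0 (by omega)
    have hd0 := hd 0 (by omega)
    have hl0 := hl 0 (by omega)
    have h10 := h1 0 (by omega)
    push_cast at hd0 hl0 h10
    simp only [zero_add, sub_zero] at hw0 hd0 hl0 h10 ih'
    rw [List.range_succ_eq_map, List.map_cons, List.map_map, Finset.sum_range_succ']
    change _ ≤ totalLevel (ℓ 0 :: (List.range r).map (fun s => ℓ (s + 1))) _
    set rest := (List.range r).map (fun s => ℓ (s + 1)) with hrest
    have hlen : (rest.length : ℝ) = r := by simp [hrest]
    rw [totalLevel, hlen]
    have hr : (0 : ℝ) ≤ r := Nat.cast_nonneg r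
    have hm : (1 : ℝ) ≤ 2 * r + 1 := by linarith
    -- `x` is the average level before the step, and `A` below is the average over the unadvised
    -- vertices after it. Since `x ≤ ℓ 0`, a uniform step from `x` reaches at least `A`.
    set x : ℝ := T 0 / (2 * ((r + 1 : ℕ) : ℝ)) with hxdef
    have hx : (2 * r + 1 + 1) * x = T 0 := by
      rw [hxdef]; push_cast; field_simp; ring
    have hxl : x ≤ ℓ 0 := by
      rw [hxdef, div_le_iff₀ (by positivity)]; push_cast; linarith
    set A : ℝ := (T 1 + d 0) / (2 * r + 1) with hA
    have hA' : (2 * r + 1) * A = T 1 + d 0 := by rw [hA]; field_simp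
    have hAy : A ≤ stepLevel (2 * r + 1) x (ℓ 0) := by
      refine le_stepLevel hm ?_ ?_
      · rw [hA, div_le_one (by linarith)]; linarith
      · rw [max_eq_left hxl, hA', hx]; linarith
    have hV := totalLevel_mono rest hAy
    -- In the last step nothing remains to be averaged, so `T 1 / (2 * r)` would be a division by
    -- zero.
    rcases Nat.eq_zero_or_pos r with h0 | hpos
    · subst h0
      simp only [zero_add] at hT
      simp only [Finset.range_zero, Finset.sum_empty, CharP.cast_eq_zero] at *
      have : rest = [] := by simp [hrest]
      rw [this, totalLevel]
      linarith
    · have hpos' : (0 : ℝ) < r := by exact_mod_cast hpos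
      have hAv : A ≤ T 1 / (2 * r) := by
        rw [le_div_iff₀ (by linarith)]
        nlinarith
      -- Dropping a vertex of level `d 0 ≤ A` raises the average of the others from `A` to `T 1 / (2
      -- * r)`. The Lipschitz bound on what this can gain is `T 1 - 2 * r * A = A - d 0`, exactly
      -- the amount by which `A` exceeds the dropped level.
      have hlip := totalLevel_sub_le rest hAv
      have e : 2 * (r : ℝ) * (T 1 / (2 * r)) = T 1 := by field_simp
      rw [hlen, mul_sub, e] at hlip
      linarith

end UniformSteps

/-! ### Water-filling as a legal greedy response -/

section WaterFilling

variable {U : Type}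

/-- `h ∈ [0, 1]` is a level to which one unit of water can raise the vertices of `N` from the levels
`x`, and is `1` if not all the water is used. -/
def IsWaterLevel (N : Finset U) (x : U → ℝ) (h : ℝ) : Prop :=
  h ≤ 1 ∧ ∑ u ∈ N, max (h - x u) 0 ≤ 1 ∧ (∑ u ∈ N, max (h - x u) 0 = 1 ∨ h = 1)

theorem exists_isWaterLevel (N : Finset U) (x : U → ℝ) (hx : ∀ u, 0 ≤ x u) :
    ∃ h, IsWaterLevel N x h := by
  rcases le_or_gt (∑ u ∈ N, max (1 - x u) 0) 1 with h | h
  · exact ⟨1, le_rfl, h, Or.inr rfl⟩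
  · have hc : ContinuousOn (fun h : ℝ => ∑ u ∈ N, max (h - x u) 0) (Set.Icc 0 1) := by fun_prop
    have h0 : ∑ u ∈ N, max (0 - x u) 0 = 0 :=
      Finset.sum_eq_zero fun u _ => max_eq_right (by linarith [hx u])
    obtain ⟨t, ht, hs⟩ := intermediate_value_Icc zero_le_one hc
      (show (1 : ℝ) ∈ Set.Icc _ _ from ⟨by rw [h0]; exact zero_le_one, h.le⟩)
    exact ⟨t, ht.2, le_of_eq hs, Or.inl hs⟩

/-- The level up to which water-filling raises the vertices of `N` from the levels `x`. -/
noncomputable def waterLevel (N : Finset U) (x : U → ℝ) : ℝ :=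
  Classical.epsilon (IsWaterLevel N x)

theorem isWaterLevel_waterLevel (N : Finset U) (x : U → ℝ) (hx : ∀ u, 0 ≤ x u) :
    IsWaterLevel N x (waterLevel N x) :=
  Classical.epsilon_spec (exists_isWaterLevel N x hx)

/-- The amounts that water-filling sends to the vertices. -/
noncomputable def waterFill (N : Finset U) (x : U → ℝ) : U → ℝ :=
  (N : Set U).indicator fun u => max (waterLevel N x - x u) 0

theorem waterFill_of_mem {N : Finset U} {u : U} (hu : u ∈ N) (x : U → ℝ) :
    waterFill N x u = max (waterLevel N x - x u) 0 :=
  Set.indicator_of_mem (Finset.mem_coe.2 hu) _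

theorem waterFill_of_notMem {N : Finset U} {u : U} (hu : u ∉ N) (x : U → ℝ) :
    waterFill N x u = 0 :=
  Set.indicator_of_notMem (by simpa using hu) _

theorem add_waterFill_of_mem {N : Finset U} {u : U} (hu : u ∈ N) (x : U → ℝ) :
    x u + waterFill N x u = max (waterLevel N x) (x u) := by
  rw [waterFill_of_mem hu, ← max_add_add_left]
  simp

theorem sum_waterFill (N : Finset U) (x : U → ℝ) :
    ∑ u ∈ N, waterFill N x u = ∑ u ∈ N, max (waterLevel N x - x u) 0 :=
  Finset.sum_congr rfl fun _ hu => waterFill_of_mem hu x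

/-- The amounts `y` are a legal and greedy response to the arrival `a` at the levels `x`. -/
structure IsGreedyResponse (a : Arrival U) (x y : U → ℝ) : Prop where
  nonneg : ∀ u, 0 ≤ y u
  eq_zero : ∀ u, u ∉ a.nbrs → y u = 0
  sum_le : ∑ u ∈ a.nbrs, y u ≤ 1
  add_le : ∀ u, x u + y u ≤ 1
  greedy : ∑ u ∈ a.nbrs, y u = 1 ∨ ∀ u ∈ a.nbrs, x u + y u = 1

theorem isGreedyResponse_waterFill (a : Arrival U) (x : U → ℝ) (h0 : ∀ u, 0 ≤ x u)
    (h1 : ∀ u, x u ≤ 1) : IsGreedyResponse a x (waterFill a.nbrs x) := by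
  obtain ⟨hl, hs, hg⟩ := isWaterLevel_waterLevel a.nbrs x h0
  refine ⟨fun u => Set.indicator_nonneg (fun _ _ => le_max_right _ _) u,
    fun u hu => waterFill_of_notMem hu x, ?_, fun u => ?_, ?_⟩
  · rwa [sum_waterFill]
  · by_cases hu : u ∈ a.nbrs
    · rw [add_waterFill_of_mem hu]
      exact max_le hl (h1 u)
    · rw [waterFill_of_notMem hu, add_zero]
      exact h1 u
  · rw [sum_waterFill]
    refine hg.imp_right fun h u hu => ?_
    rw [add_waterFill_of_mem hu, h, max_eq_left (h1 u)]

end WaterFilling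

/-! ### Algorithms built from rules that see only round, arrival and levels -/

namespace FractionalAlgorithm

variable {U : Type}

/-- The levels reached by the rule that sends the amounts `rule s a x` if the arrival `a` comes
after `s` others and finds the levels `x`. -/
noncomputable def ruleLevel (rule : ℕ → Arrival U → (U → ℝ) → U → ℝ) :
    List (Arrival U) → U → ℝ
  | [], _ => 0
  | a :: past, u => ruleLevel rule past u + rule past.length a (ruleLevel rule past) u

theorem ruleLevel_mem_Icc {rule : ℕ → Arrival U → (U → ℝ) → U → ℝ}
    (hr : ∀ s a x, (∀ u, 0 ≤ x u) → (∀ u, x u ≤ 1) → IsGreedyResponse a x (rule s a x))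
    (past : List (Arrival U)) (u : U) : ruleLevel rule past u ∈ Set.Icc (0 : ℝ) 1 := by
  induction past generalizing u with
  | nil => simp [ruleLevel]
  | cons a past ih =>
    have := hr past.length a _ (fun u => (ih u).1) (fun u => (ih u).2)
    exact ⟨add_nonneg (ih u).1 (this.nonneg u), this.add_le u⟩

theorem isGreedyResponse_ruleLevel {rule : ℕ → Arrival U → (U → ℝ) → U → ℝ}
    (hr : ∀ s a x, (∀ u, 0 ≤ x u) → (∀ u, x u ≤ 1) → IsGreedyResponse a x (rule s a x))
    (past : List (Arrival U)) (a : Arrival U) :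
    IsGreedyResponse a (ruleLevel rule past) (rule past.length a (ruleLevel rule past)) :=
  hr _ _ _ (fun u => (ruleLevel_mem_Icc hr past u).1) fun u => (ruleLevel_mem_Icc hr past u).2

theorem levelOf_ruleLevel (rule : ℕ → Arrival U → (U → ℝ) → U → ℝ) (past : List (Arrival U))
    (u : U) :
    levelOf (fun past a => rule past.length a (ruleLevel rule past)) past u =
      ruleLevel rule past u := by
  induction past with
  | nil => rfl
  | cons a past ih => simp only [levelOf, ruleLevel, ih]

/-- The algorithm that follows a legal and greedy rule. -/
noncomputable def ofRule (rule : ℕ → Arrival U → (U → ℝ) → U → ℝ)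
    (hr : ∀ s a x, (∀ u, 0 ≤ x u) → (∀ u, x u ≤ 1) → IsGreedyResponse a x (rule s a x)) :
    FractionalAlgorithm U where
  push past a := rule past.length a (ruleLevel rule past)
  push_nonneg past a := (isGreedyResponse_ruleLevel hr past a).nonneg
  push_eq_zero past a := (isGreedyResponse_ruleLevel hr past a).eq_zero
  sum_push_le_one past a := (isGreedyResponse_ruleLevel hr past a).sum_le
  level_le_one past u := by
    rw [levelOf_ruleLevel]
    exact (ruleLevel_mem_Icc hr past u).2

theorem level_ofRule {rule : ℕ → Arrival U → (U → ℝ) → U → ℝ}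
    (hr : ∀ s a x, (∀ u, 0 ≤ x u) → (∀ u, x u ≤ 1) → IsGreedyResponse a x (rule s a x)) :
    (ofRule rule hr).level = ruleLevel rule := by
  ext past u
  exact levelOf_ruleLevel rule past u

theorem push_ofRule {rule : ℕ → Arrival U → (U → ℝ) → U → ℝ}
    (hr : ∀ s a x, (∀ u, 0 ≤ x u) → (∀ u, x u ≤ 1) → IsGreedyResponse a x (rule s a x))
    (past : List (Arrival U)) (a : Arrival U) :
    (ofRule rule hr).push past a = rule past.length a ((ofRule rule hr).level past) := by
  rw [level_ofRule]
  rfl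

theorem greedy_ofRule {rule : ℕ → Arrival U → (U → ℝ) → U → ℝ}
    (hr : ∀ s a x, (∀ u, 0 ≤ x u) → (∀ u, x u ≤ 1) → IsGreedyResponse a x (rule s a x)) :
    (ofRule rule hr).Greedy := by
  intro past a
  rw [level_ofRule]
  exact (isGreedyResponse_ruleLevel hr past a).greedy

variable (M : FractionalAlgorithm U)

theorem level_cons (past : List (Arrival U)) (a : Arrival U) (u : U) :
    M.level (a :: past) u = M.level past u + M.push past a u := rfl

theorem level_le_level_cons (past : List (Arrival U)) (a : Arrival U) (u : U) :
    M.level past u ≤ M.level (a :: past) u := by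
  rw [level_cons]
  linarith [M.push_nonneg past a u]

theorem level_cons_of_notMem (past : List (Arrival U)) {a : Arrival U} {u : U}
    (hu : u ∉ a.nbrs) : M.level (a :: past) u = M.level past u := by
  rw [level_cons, M.push_eq_zero past a u hu, add_zero]

theorem level_le (past : List (Arrival U)) (u : U) : M.level past u ≤ 1 := M.level_le_one past u

theorem value_eq_sum_level [Fintype U] (past : List (Arrival U)) :
    M.value past = ∑ u, M.level past u := by
  induction past with
  | nil => simp [value, level, levelOf]
  | cons a past ih =>
    simp only [value, level_cons, Finset.sum_add_distrib, ih]
    congr 1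
    exact Finset.sum_subset (Finset.subset_univ _) fun u _ hu => M.push_eq_zero past a u hu

end FractionalAlgorithm

/-! ### Levels as sequences along an ordering -/

section Profile

variable {N : ℕ}

/-- The values of `f` along the ordering `σ`, as a sequence. -/
noncomputable def profile (f : Fin N → ℝ) (σ : Equiv.Perm (Fin N)) (i : ℕ) : ℝ :=
  if h : i < N then f (σ ⟨i, h⟩) else 0

theorem profile_val (f : Fin N → ℝ) (σ : Equiv.Perm (Fin N)) (i : Fin N) :
    profile f σ i = f (σ i) := by
  simp [profile]

theorem profile_nonneg {f : Fin N → ℝ} (hf : ∀ u, 0 ≤ f u) (σ : Equiv.Perm (Fin N)) (i : ℕ) :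
    0 ≤ profile f σ i := by
  unfold profile
  split_ifs
  exacts [hf _, le_rfl]

theorem profile_le_one {f : Fin N → ℝ} (hf : ∀ u, f u ≤ 1) (σ : Equiv.Perm (Fin N)) (i : ℕ) :
    profile f σ i ≤ 1 := by
  unfold profile
  split_ifs
  exacts [hf _, zero_le_one]

theorem sum_range_profile (f : Fin N → ℝ) (σ : Equiv.Perm (Fin N)) :
    ∑ i ∈ Finset.range N, profile f σ i = ∑ u, f u := by
  rw [← Fin.sum_univ_eq_sum_range, ← Equiv.sum_comp σ f]
  exact Finset.sum_congr rfl fun i _ => profile_val f σ i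

theorem sum_profile_le (f : Fin N → ℝ) (hf : ∀ u, 0 ≤ f u) (σ : Equiv.Perm (Fin N))
    (I : Finset ℕ) : ∑ i ∈ I, profile f σ i ≤ ∑ u, f u := by
  rw [← sum_range_profile f σ]
  refine (Finset.sum_le_sum_of_subset_of_nonneg
    (Finset.subset_union_left (s₂ := Finset.range N))
    fun i _ _ => profile_nonneg hf σ i).trans (le_of_eq ?_)
  refine (Finset.sum_subset (Finset.subset_union_right (s₁ := I)) fun i _ hi => ?_).symm
  exact dif_neg (by simpa using hi)

variable {σ σ' : Equiv.Perm (Fin N)} {B : Finset (Fin N)} {lo hi : ℕ}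

theorem profile_eq_of_fixed (hB : ∀ j : Fin N, j ∈ B ↔ lo ≤ j.val ∧ j.val < hi)
    (hσ : ∀ i ∉ B, σ' i = σ i) (f : Fin N → ℝ) {i : ℕ} (hi' : i < lo ∨ hi ≤ i) :
    profile f σ' i = profile f σ i := by
  unfold profile
  split_ifs with h
  · rw [hσ]
    rw [hB]
    intro hc
    simp only at hc
    omega
  · rfl

theorem sum_Ico_profile_eq_of_fixed (hB : ∀ j : Fin N, j ∈ B ↔ lo ≤ j.val ∧ j.val < hi)
    (hσ : ∀ i ∉ B, σ' i = σ i) (f : Fin N → ℝ) (hN : hi ≤ N) :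
    ∑ i ∈ Finset.Ico lo hi, profile f σ' i = ∑ i ∈ Finset.Ico lo hi, profile f σ i := by
  have hsub : Finset.Ico lo hi ⊆ Finset.range N := fun i h => by
    simp only [Finset.mem_Ico, Finset.mem_range] at h ⊢; omega
  have h1 := Finset.sum_sdiff (f := profile f σ) hsub
  have h2 := Finset.sum_sdiff (f := profile f σ') hsub
  have h3 : ∑ i ∈ Finset.range N \ Finset.Ico lo hi, profile f σ' i =
      ∑ i ∈ Finset.range N \ Finset.Ico lo hi, profile f σ i :=
    Finset.sum_congr rfl fun i h => profile_eq_of_fixed hB hσ f (by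
      simp only [Finset.mem_sdiff, Finset.mem_range, Finset.mem_Ico] at h; omega)
  rw [sum_range_profile] at h1 h2
  linarith

/-- Sorting a block into nondecreasing order does not increase any prefix sum. -/
theorem sum_range_profile_le_of_monotoneOn (hσ : ∀ i ∉ B, σ' i = σ i) (f : Fin N → ℝ)
    (hm : MonotoneOn (fun i => f (σ' i)) (B : Set (Fin N))) (j : ℕ) :
    ∑ i ∈ Finset.range j, profile f σ' i ≤ ∑ i ∈ Finset.range j, profile f σ i := by
  have key : ∀ τ : Equiv.Perm (Fin N), ∑ i ∈ Finset.range j, profile f τ i =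
      ∑ i : Fin N, (if i.val < j then (1 : ℝ) else 0) * f (τ i) := by
    intro τ
    have : ∀ i : Fin N, (if i.val < j then (1 : ℝ) else 0) * f (τ i) =
        (fun i : ℕ => if i < j then profile f τ i else 0) i := by
      intro i
      simp only [profile_val]
      split_ifs <;> simp
    rw [Finset.sum_congr rfl fun i _ => this i,
      Fin.sum_univ_eq_sum_range (fun i : ℕ => if i < j then profile f τ i else 0),
      ← Finset.sum_filter]
    refine (Finset.sum_subset_zero_on_sdiff (fun i hi => ?_) (fun i hi => ?_)
      fun _ _ => rfl).symm
    · simp only [Finset.mem_filter, Finset.mem_range] at hi ⊢; exact hi.2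
    · simp only [Finset.mem_sdiff, Finset.mem_filter, Finset.mem_range] at hi
      exact dif_neg (by tauto)
  rw [key, key, ← Finset.sum_add_sum_compl B, ← Finset.sum_add_sum_compl B]
  refine add_le_add ?_ (le_of_eq (Finset.sum_congr rfl fun i hi => ?_))
  -- Rearrangement inequality: the weights of a prefix are nonincreasing, so pairing them with
  -- nondecreasing values minimises the sum.
  · have hav : AntivaryOn (fun i : Fin N => if i.val < j then (1 : ℝ) else 0)
        (fun i => f (σ' i)) (B : Set (Fin N)) := by
      intro i hi k hk hik
      have : i < k := by
        by_contra h
        exact absurd (hm hk hi (not_lt.1 h)) (not_le.2 hik)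
      have hv : i.val < k.val := this
      dsimp only
      split_ifs <;> first | omega | norm_num
    have := hav.sum_mul_le_sum_mul_comp_perm (σ := σ.trans σ'.symm) (fun i hi => by
      by_contra h
      refine hi ?_
      simp [← hσ i h])
    simpa using this
  · rw [hσ i (Finset.mem_compl.1 hi)]

/-- The full lists of values are permutations of each other, and their tails from `hi` on coincide
and can be cancelled. -/
theorem perm_map_profile (hB : ∀ j : Fin N, j ∈ B ↔ j.val < hi)
    (hσ : ∀ i ∉ B, σ' i = σ i) (f : Fin N → ℝ) (hN : hi ≤ N) :
    ((List.range hi).map (profile f σ)).Perm ((List.range hi).map (profile f σ')) := by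
  have hof : ∀ τ : Equiv.Perm (Fin N), (List.range N).map (profile f τ) =
      List.ofFn fun i => f (τ i) := by
    intro τ
    apply List.ext_getElem <;> simp +contextual [profile]
  have h1 : ((List.range N).map (profile f σ)).Perm ((List.range N).map (profile f σ')) := by
    rw [hof, hof]
    have := Equiv.Perm.ofFn_comp_perm (σ'.trans σ.symm) (fun i => f (σ i))
    simpa [Function.comp_def] using this.symm
  obtain ⟨r, rfl⟩ := Nat.exists_eq_add_of_le hN
  rw [List.range_add, List.map_append, List.map_append] at h1
  have h2 : ((List.range r).map (hi + ·)).map (profile f σ) =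
      ((List.range r).map (hi + ·)).map (profile f σ') := by
    simp only [List.map_map]
    refine List.map_congr_left fun i _ => ?_
    exact (profile_eq_of_fixed (lo := 0) (by simpa using hB) hσ f (Or.inr (by simp))).symm
  rw [h2] at h1
  exact (List.perm_append_right_iff _).1 h1

theorem le_of_monotoneOn_profile (hB : ∀ j : Fin N, j ∈ B ↔ lo ≤ j.val ∧ j.val < hi)
    {f : Fin N → ℝ} (hm : MonotoneOn (fun i => f (σ i)) (B : Set (Fin N))) (hN : hi ≤ N) {i j : ℕ}
    (hi0 : lo ≤ i) (hij : i ≤ j) (hj : j < hi) : profile f σ i ≤ profile f σ j := by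
  have h1 : i < N := by omega
  have h2 : j < N := by omega
  simp only [profile, h1, h2, dif_pos]
  exact hm (Finset.mem_coe.2 ((hB _).2 ⟨hi0, by simp only; omega⟩))
    (Finset.mem_coe.2 ((hB _).2 ⟨by simp only; omega, hj⟩)) (by simpa using hij)

variable (M : FractionalAlgorithm (Fin N)) (past : List (Arrival (Fin N)))

theorem profile_level_cons {a : Arrival (Fin N)}
    (ha : a.nbrs = B.image σ) (hB : ∀ j : Fin N, j ∈ B ↔ lo ≤ j.val ∧ j.val < hi)
    {i : ℕ} (hi' : i < lo ∨ hi ≤ i) :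
    profile (M.level (a :: past)) σ i = profile (M.level past) σ i := by
  unfold profile
  split_ifs with h
  · refine M.level_cons_of_notMem past ?_
    rw [ha, Finset.mem_image]
    rintro ⟨j, hj, hji⟩
    rw [σ.injective hji, hB] at hj
    simp only at hj
    omega
  · rfl

theorem profile_le_profile_level_cons (a : Arrival (Fin N)) (i : ℕ) :
    profile (M.level past) σ i ≤ profile (M.level (a :: past)) σ i := by
  unfold profile
  split_ifs
  exacts [M.level_le_level_cons past a _, le_rfl]

theorem sum_profile_level_cons_le (a : Arrival (Fin N)) (I : Finset ℕ) :
    ∑ i ∈ I, profile (M.level (a :: past)) σ i ≤ ∑ i ∈ I, profile (M.level past) σ i + 1 := by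
  have h : ∀ i, profile (M.level (a :: past)) σ i =
      profile (M.level past) σ i + profile (M.push past a) σ i := by
    intro i
    unfold profile
    split_ifs
    exacts [M.level_cons past a _, (add_zero 0).symm]
  rw [Finset.sum_congr rfl fun i _ => h i, Finset.sum_add_distrib]
  have h1 := sum_profile_le (M.push past a) (M.push_nonneg past a) σ I
  have h2 : ∑ u ∈ a.nbrs, M.push past a u = ∑ u, M.push past a u :=
    Finset.sum_subset (Finset.subset_univ _) fun u _ hu => M.push_eq_zero past a u hu
  linarith [M.sum_push_le_one past a]

end Profile

/-! ### Runs of an arbitrary algorithm against the adversaries -/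

section Blocks

variable {n : ℕ}

theorem mem_commonBlock (s : ℕ) (j : Fin (2 * n)) :
    j ∈ commonBlock n s ↔ s + 1 ≤ j.val ∧ j.val < 2 * n - s := by
  simp only [commonBlock, Finset.mem_filter, Finset.mem_univ, true_and]
  omega

theorem mem_robustBlock (k : ℕ) (j : Fin (2 * n)) :
    j ∈ robustBlock n k ↔ k ≤ j.val ∧ j.val < n := by
  simp [robustBlock]

theorem mem_commonNbrs (s : ℕ) (j : Fin (2 * n)) :
    j ∈ Finset.univ.filter (fun j : Fin (2 * n) => s ≤ j.val ∧ j.val + s < 2 * n) ↔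
      s ≤ j.val ∧ j.val < 2 * n - s := by
  simp only [Finset.mem_filter, Finset.mem_univ, true_and]
  omega

theorem mem_consistencyNbrs (k : ℕ) (j : Fin (2 * n)) :
    j ∈ Finset.univ.filter (fun j : Fin (2 * n) => j.val = n + k) ↔
      n + k ≤ j.val ∧ j.val < n + k + 1 := by
  simp only [Finset.mem_filter, Finset.mem_univ, true_and]
  omega

end Blocks

section Runs

variable {n : ℕ} (ρ : ReorderRule n) (M : FractionalAlgorithm (Fin (2 * n)))

/-- The levels of `M` along the current ordering. -/
noncomputable def AdversaryState.levels (M : FractionalAlgorithm (Fin (2 * n)))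
    (S : AdversaryState n) : ℕ → ℝ :=
  profile (M.level S.past) S.order

theorem AdversaryState.levels_le_one (S : AdversaryState n) (i : ℕ) : S.levels M i ≤ 1 :=
  profile_le_one (M.level_le _) _ _

theorem FractionalAlgorithm.level_nonneg {U : Type} (M : FractionalAlgorithm U)
    (past : List (Arrival U)) (u : U) : 0 ≤ M.level past u := by
  induction past with
  | nil => exact le_rfl
  | cons a past ih => exact ih.trans (M.level_le_level_cons past a u)

theorem commonState_levels_zero (i : ℕ) : (commonState ρ M 0).levels M i = 0 := by
  simp [AdversaryState.levels, commonState, profile, FractionalAlgorithm.level, levelOf]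

theorem commonState_levels_succ (s : ℕ) {i : ℕ} (hi : i < s ∨ 2 * n - s ≤ i) :
    (commonState ρ M (s + 1)).levels M i = (commonState ρ M s).levels M i := by
  refine (profile_eq_of_fixed (mem_commonBlock s) (ρ.fixed _ _ _ _) _ (by omega)).trans ?_
  exact profile_level_cons M _ rfl (mem_commonNbrs s) hi

/-- Once an index has left the neighbourhood, it neither receives water nor is sorted. Hence advised
and dropped levels may be read off either right after their step or at the end of the common phase.
-/
theorem commonState_levels_of_le {s t : ℕ} (hst : s ≤ t) {i : ℕ} (hi : i < s ∨ 2 * n - s ≤ i) :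
    (commonState ρ M t).levels M i = (commonState ρ M s).levels M i := by
  induction t, hst using Nat.le_induction with
  | base => rfl
  | succ t hst ih => rw [commonState_levels_succ ρ M t (by omega), ih]

theorem commonState_levels_antitone (s : ℕ) {i j : ℕ} (hi : s + 1 ≤ i) (hij : i ≤ j)
    (hj : j < 2 * n - s) :
    (commonState ρ M (s + 1)).levels M j ≤ (commonState ρ M (s + 1)).levels M i := by
  have h := ρ.sorted (commonState ρ M (s + 1)).past
    (fun u => - M.level (commonState ρ M (s + 1)).past u) (commonBlock n s) (commonState ρ M s).order
  have := le_of_monotoneOn_profile (σ := (commonState ρ M (s + 1)).order)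
    (f := fun u => - M.level (commonState ρ M (s + 1)).past u) (mem_commonBlock s) h (by omega)
    hi hij hj
  have e : ∀ i, profile (fun u => - M.level (commonState ρ M (s + 1)).past u)
      (commonState ρ M (s + 1)).order i = - (commonState ρ M (s + 1)).levels M i := by
    intro i
    unfold AdversaryState.levels profile
    split_ifs <;> simp
  have h' : - (commonState ρ M (s + 1)).levels M i ≤ - (commonState ρ M (s + 1)).levels M j := by
    rw [← e, ← e]; exact this
  linarith

theorem commonState_sum_levels_succ (s : ℕ) (hs : s < n) :
    ∑ i ∈ Finset.Ico s (2 * n - s), (commonState ρ M (s + 1)).levels M i ≤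
      ∑ i ∈ Finset.Ico s (2 * n - s), (commonState ρ M s).levels M i + 1 := by
  have h := sum_profile_level_cons_le M (commonState ρ M s).past (σ := (commonState ρ M s).order)
    (commonArrival n s (commonState ρ M s).order) (Finset.Ico s (2 * n - s))
  refine le_trans (le_of_eq ?_) h
  have e := fun f : ℕ → ℝ => Finset.sum_eq_sum_Ico_succ_bot (show s < 2 * n - s by omega) f
  rw [e, e]
  congr 1
  · exact profile_eq_of_fixed (mem_commonBlock s) (ρ.fixed _ _ _ _) _ (by omega)
  · exact sum_Ico_profile_eq_of_fixed (mem_commonBlock s) (ρ.fixed _ _ _ _) _ (by omega)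

/-- What the common phase leaves on the vertices that are not advised is at most what uniform steps
achieve, with the final levels of the advised vertices as targets. -/
theorem sum_unadvised_le_totalLevel :
    ∑ i ∈ Finset.Ico n (2 * n), (commonState ρ M n).levels M i ≤
      totalLevel ((List.range n).map ((commonState ρ M n).levels M)) 0 := by
  set p : ℕ → ℕ → ℝ := fun s => (commonState ρ M s).levels M with hp
  have hlevel : ∀ s < n, p n s = p (s + 1) s := fun s hs =>
    commonState_levels_of_le ρ M (by omega) (by omega)
  have hdrop : ∀ s < n, p n (2 * n - 1 - s) = p (s + 1) (2 * n - 1 - s) := fun s hs =>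
    commonState_levels_of_le ρ M (by omega) (by omega)
  have hsum : ∑ i ∈ Finset.Ico n (2 * n), p n i = ∑ s ∈ Finset.range n, p n (2 * n - 1 - s) := by
    rw [Finset.sum_Ico_eq_sum_range, ← Finset.sum_range_reflect]
    refine Finset.sum_congr (by congr 1; omega) fun s hs => ?_
    congr 1
    have := Finset.mem_range.1 hs
    omega
  set T : ℕ → ℝ := fun s => ∑ i ∈ Finset.Ico s (2 * n - s), p s i with hT
  have hT0 : T 0 = 0 := Finset.sum_eq_zero fun i _ => commonState_levels_zero ρ M i
  have hTn : T n = 0 := by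
    simp only [hT]
    rw [Finset.Ico_eq_empty (by omega), Finset.sum_empty]
  have hsplit : ∀ s < n, ∑ i ∈ Finset.Ico (s + 1) (2 * n - s), p (s + 1) i =
      T (s + 1) + p n (2 * n - 1 - s) := by
    intro s hs
    have e : 2 * n - s = 2 * n - (s + 1) + 1 := by omega
    rw [e, Finset.sum_Ico_succ_top (by omega), hdrop s hs]
    congr 2
    omega
  have hcast : ∀ s < n, ((2 * n - s - (s + 1) : ℕ) : ℝ) = 2 * ((n : ℝ) - s) - 1 := by
    intro s hs
    rw [Nat.cast_sub (by omega), Nat.cast_sub (by omega)]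
    push_cast
    ring
  -- The index dropped after step `s` is `2 * n - 1 - s`, the last of the block just sorted. The
  -- four conditions are: at most one unit of water arrives; the dropped level is the smallest; the
  -- advised level is at least the previous average; no level exceeds 1.
  have := sum_le_totalLevel n (p n) (fun s => p n (2 * n - 1 - s)) T ?_ ?_ ?_ ?_ hTn
  · rwa [hT0, zero_div, ← hsum] at this
  · intro s hs
    have h := commonState_sum_levels_succ ρ M s hs
    rw [Finset.sum_eq_sum_Ico_succ_bot (by omega)] at h
    have h' := hsplit s hs
    have h'' := hlevel s hs
    simp only [hp, hT] at h h' h'' ⊢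
    linarith
  · intro s hs
    have h := Finset.card_nsmul_le_sum (Finset.Ico (s + 1) (2 * n - (s + 1))) (p (s + 1))
      (p n (2 * n - 1 - s)) fun i hi => by
        rw [Finset.mem_Ico] at hi
        rw [hdrop s hs]
        exact commonState_levels_antitone ρ M s hi.1 (by omega) (by omega)
    rw [Nat.card_Ico, nsmul_eq_mul] at h
    have e : ((2 * n - (s + 1) - (s + 1) : ℕ) : ℝ) = 2 * ((n : ℝ) - s) - 2 := by
      rw [Nat.cast_sub (by omega), Nat.cast_sub (by omega)]
      push_cast
      ring
    rw [e] at h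
    linarith
  · intro s hs
    have h := Finset.sum_le_card_nsmul (Finset.Ico s (2 * n - s)) (p s) (p n s) fun i hi => by
      rw [Finset.mem_Ico] at hi
      -- No sorting precedes step 0, but all levels are 0 then. Later, the preceding sort has put
      -- the largest level at the advised index, which can only rise further.
      rcases s with _ | s
      · exact (commonState_levels_zero ρ M i).le.trans (profile_nonneg (M.level_nonneg _) _ _)
      · have h1 : p (s + 1) i ≤ p (s + 1) (s + 1) :=
          commonState_levels_antitone ρ M s le_rfl hi.1 (by omega)
        refine h1.trans ?_
        rw [hlevel _ hs]
        refine le_trans (profile_le_profile_level_cons M _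
          (commonArrival n (s + 1) (commonState ρ M (s + 1)).order) _) (le_of_eq ?_)
        exact (profile_eq_of_fixed (mem_commonBlock (s + 1)) (ρ.fixed _ _ _ _) _ (by omega)).symm
    rw [Nat.card_Ico, nsmul_eq_mul] at h
    have e : ((2 * n - s - s : ℕ) : ℝ) = 2 * ((n : ℝ) - s) := by
      rw [Nat.cast_sub (by omega), Nat.cast_sub (by omega)]
      push_cast
      ring
    rwa [e] at h
  · intro s hs
    rw [← hsplit s hs, ← hcast s hs]
    have h := Finset.sum_le_card_nsmul (Finset.Ico (s + 1) (2 * n - s)) (p (s + 1)) 1 fun i hi =>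
      AdversaryState.levels_le_one M _ i
    rwa [Nat.card_Ico, nsmul_eq_mul, mul_one] at h

theorem robustState_levels_zero {i : ℕ} (hi : n ≤ i) :
    (robustState ρ M 0).levels M i = (commonState ρ M n).levels M i :=
  profile_eq_of_fixed (mem_robustBlock 0) (ρ.fixed _ _ _ _) _ (Or.inr hi)

theorem sum_robustState_levels_zero :
    ∑ i ∈ Finset.range n, (robustState ρ M 0).levels M i =
      ∑ i ∈ Finset.range n, (commonState ρ M n).levels M i := by
  rw [Finset.range_eq_Ico]
  exact sum_Ico_profile_eq_of_fixed (mem_robustBlock 0) (ρ.fixed _ _ _ _) _ (by omega)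

theorem perm_robustState_levels_zero :
    ((List.range n).map ((commonState ρ M n).levels M)).Perm
      ((List.range n).map ((robustState ρ M 0).levels M)) :=
  perm_map_profile (by simpa using mem_robustBlock (n := n) 0) (ρ.fixed _ _ _ _) _ (by omega)

theorem robustState_levels_zero_mono {i j : ℕ} (hij : i ≤ j) (hj : j < n) :
    (robustState ρ M 0).levels M i ≤ (robustState ρ M 0).levels M j :=
  le_of_monotoneOn_profile (mem_robustBlock 0) (ρ.sorted _ _ _ _) (by omega) (Nat.zero_le _) hij hj

theorem robustState_levels_succ_mono (k : ℕ) {i j : ℕ} (hi : k ≤ i) (hij : i ≤ j) (hj : j < n) :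
    (robustState ρ M (k + 1)).levels M i ≤ (robustState ρ M (k + 1)).levels M j :=
  le_of_monotoneOn_profile (mem_robustBlock k) (ρ.sorted _ _ _ _) (by omega) hi hij hj

theorem robustState_levels_succ (k : ℕ) {i : ℕ} (hi : i < k ∨ n ≤ i) :
    (robustState ρ M (k + 1)).levels M i = (robustState ρ M k).levels M i := by
  refine (profile_eq_of_fixed (mem_robustBlock k) (ρ.fixed _ _ _ _) _ hi).trans ?_
  exact profile_level_cons M _ rfl (mem_robustBlock k) hi

/-- One arrival adds at most one unit to a prefix along the old ordering, and the sorting that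
follows cannot raise a prefix sum. -/
theorem sum_robustState_levels_succ_le (k j : ℕ) :
    ∑ i ∈ Finset.range j, (robustState ρ M (k + 1)).levels M i ≤
      ∑ i ∈ Finset.range j, (robustState ρ M k).levels M i + 1 :=
  (sum_range_profile_le_of_monotoneOn (B := robustBlock n k) (ρ.fixed _ _ _ _) _
    (ρ.sorted _ _ _ _) j).trans (sum_profile_level_cons_le M _ _ _)

theorem robustState_levels_of_le (k : ℕ) {i : ℕ} (hi : n ≤ i) :
    (robustState ρ M k).levels M i = (commonState ρ M n).levels M i := by
  induction k with
  | zero => exact robustState_levels_zero ρ M hi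
  | succ k ih => rw [robustState_levels_succ ρ M k (Or.inr hi), ih]

theorem value_eq_sum_levels (S : AdversaryState n) :
    M.value S.past = ∑ i ∈ Finset.range n, S.levels M i +
      ∑ i ∈ Finset.Ico n (2 * n), S.levels M i := by
  rw [M.value_eq_sum_level, ← sum_range_profile _ S.order,
    ← Finset.sum_range_add_sum_Ico _ (by omega : n ≤ 2 * n)]
  rfl

theorem robustValue_eq :
    robustValue ρ M = ∑ i ∈ Finset.range n, (robustState ρ M n).levels M i +
      ∑ i ∈ Finset.Ico n (2 * n), (commonState ρ M n).levels M i := by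
  rw [robustValue, value_eq_sum_levels]
  congr 1
  exact Finset.sum_congr rfl fun i hi =>
    robustState_levels_of_le ρ M n (Finset.mem_Ico.1 hi).1

theorem consistencyState_levels_succ (k : ℕ) {i : ℕ} (hi : i ≠ n + k) :
    (consistencyState ρ M (k + 1)).levels M i = (consistencyState ρ M k).levels M i :=
  profile_level_cons M _ rfl (mem_consistencyNbrs k) (by omega)

theorem consistencyState_levels_of_lt (k : ℕ) {i : ℕ} (hi : i < n) :
    (consistencyState ρ M k).levels M i = (commonState ρ M n).levels M i := by
  induction k with
  | zero => rfl
  | succ k ih => rw [consistencyState_levels_succ ρ M k (by omega), ih]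

theorem consistencyValue_le :
    consistencyValue ρ M ≤ ∑ i ∈ Finset.range n, (commonState ρ M n).levels M i + n := by
  rw [consistencyValue, value_eq_sum_levels]
  refine add_le_add (le_of_eq (Finset.sum_congr rfl fun i hi =>
    consistencyState_levels_of_lt ρ M n (Finset.mem_range.1 hi))) ?_
  have h := Finset.sum_le_card_nsmul (Finset.Ico n (2 * n)) ((consistencyState ρ M n).levels M) 1
    fun i _ => AdversaryState.levels_le_one M _ i
  rw [Nat.card_Ico, nsmul_eq_mul, mul_one] at h
  have e : 2 * n - n = n := by omega
  rwa [e] at h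

theorem FractionalAlgorithm.Greedy.consistencyState_levels_succ_eq_one
    {M : FractionalAlgorithm (Fin (2 * n))} (hM : M.Greedy) {k : ℕ} (hk : k < n) :
    (consistencyState ρ M (k + 1)).levels M (n + k) = 1 := by
  have hlt : n + k < 2 * n := by omega
  set S := consistencyState ρ M k with hS
  have hnbrs : (consistencyArrival n k S.order).nbrs = {S.order ⟨n + k, hlt⟩} := by
    have : (Finset.univ.filter fun j : Fin (2 * n) => j.val = n + k) = {⟨n + k, hlt⟩} := by
      ext j
      simp [Fin.ext_iff]
    simp only [consistencyArrival, this, Finset.image_singleton]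
  have hgoal : M.level (consistencyArrival n k S.order :: S.past) (S.order ⟨n + k, hlt⟩) = 1 := by
    rcases hM S.past (consistencyArrival n k S.order) with h | h
    · rw [hnbrs, Finset.sum_singleton] at h
      refine le_antisymm (M.level_le _ _) ?_
      rw [M.level_cons, h]
      linarith [M.level_nonneg S.past (S.order ⟨n + k, hlt⟩)]
    · exact h _ (by rw [hnbrs]; exact Finset.mem_singleton_self _)
  have e : (consistencyState ρ M (k + 1)).levels M (n + k) =
      profile (M.level (consistencyArrival n k S.order :: S.past)) S.order (n + k) := rfl
  rw [e, profile, dif_pos hlt, hgoal]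

theorem FractionalAlgorithm.Greedy.consistencyState_levels_eq_one
    {M : FractionalAlgorithm (Fin (2 * n))} (hM : M.Greedy) {i k : ℕ} (hk : k ≤ n) (hi : n ≤ i)
    (hik : i < n + k) : (consistencyState ρ M k).levels M i = 1 := by
  induction k with
  | zero => omega
  | succ k ih =>
    rcases eq_or_ne i (n + k) with rfl | h
    · exact hM.consistencyState_levels_succ_eq_one ρ (by omega)
    · rw [consistencyState_levels_succ ρ M k h]
      exact ih (by omega) (by omega)

theorem FractionalAlgorithm.Greedy.consistencyValue_eq
    {M : FractionalAlgorithm (Fin (2 * n))} (hM : M.Greedy) :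
    consistencyValue ρ M = ∑ i ∈ Finset.range n, (commonState ρ M n).levels M i + n := by
  rw [consistencyValue, value_eq_sum_levels]
  congr 1
  · exact Finset.sum_congr rfl fun i hi =>
      consistencyState_levels_of_lt ρ M n (Finset.mem_range.1 hi)
  · rw [Finset.sum_congr rfl fun i hi => hM.consistencyState_levels_eq_one ρ le_rfl
      (Finset.mem_Ico.1 hi).1 (by have := (Finset.mem_Ico.1 hi).2; omega)]
    rw [Finset.sum_const, Nat.card_Ico, nsmul_eq_mul, mul_one]
    congr 1
    omega

end Runs

/-! ### The uniform algorithm: planned levels and legality -/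

section UniformPlan

variable (n : ℕ) (ℓ : ℕ → ℝ)

/-- The common level of the vertices that are still present after `s` uniform steps. -/
noncomputable def baseLevel : ℕ → ℝ
  | 0 => 0
  | s + 1 => stepLevel (2 * ((n : ℝ) - s) - 1) (baseLevel s) (ℓ s)

/-- The level that the advised vertex reaches in the uniform step `s`. -/
noncomputable def advisedLevel (s : ℕ) : ℝ :=
  min 1 (1 + 2 * ((n : ℝ) - s) * baseLevel n ℓ s -
    (2 * ((n : ℝ) - s) - 1) * baseLevel n ℓ (s + 1))

/-- The levels after `s` uniform steps in the common phase. -/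
noncomputable def plannedLevel (s : ℕ) (i : Fin (2 * n)) : ℝ :=
  if i.val < s then advisedLevel n ℓ i else baseLevel n ℓ (min s (2 * n - i))

variable {n ℓ}

theorem one_le_of_lt {s : ℕ} (hs : s < n) : (1 : ℝ) ≤ 2 * ((n : ℝ) - s) - 1 := by
  have : (s : ℝ) + 1 ≤ n := by exact_mod_cast hs
  linarith

theorem baseLevel_mem_Icc (hℓ : ∀ s, ℓ s ≤ 1) {s : ℕ} (hs : s ≤ n) :
    baseLevel n ℓ s ∈ Set.Icc (0 : ℝ) 1 := by
  induction s with
  | zero => simp [baseLevel]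
  | succ s ih =>
    have ih' := ih (by omega)
    exact ⟨ih'.1.trans (self_le_stepLevel (one_le_of_lt (by omega)) ih'.1 ih'.2 (hℓ s)),
      stepLevel_le_one⟩

theorem baseLevel_le_succ (hℓ : ∀ s, ℓ s ≤ 1) {s : ℕ} (hs : s < n) :
    baseLevel n ℓ s ≤ baseLevel n ℓ (s + 1) :=
  have h := baseLevel_mem_Icc hℓ hs.le
  self_le_stepLevel (one_le_of_lt hs) h.1 h.2 (hℓ s)

theorem advisedLevel_le_one (s : ℕ) : advisedLevel n ℓ s ≤ 1 := min_le_left _ _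

theorem max_le_advisedLevel (hℓ : ∀ s, ℓ s ≤ 1) {s : ℕ} (hs : s < n) :
    max (ℓ s) (baseLevel n ℓ s) ≤ advisedLevel n ℓ s := by
  have h := mul_stepLevel_le (x := baseLevel n ℓ s) (a := ℓ s) (one_le_of_lt hs)
  refine le_min (max_le (hℓ s) (baseLevel_mem_Icc hℓ hs.le).2) ?_
  rw [baseLevel]
  linarith

/-- Unless the cap at 1 stops the unadvised vertices, they absorb all that the target leaves, and
nothing flows back to the advised vertex. -/
theorem advisedLevel_eq_or (hℓ : ∀ s, ℓ s ≤ 1) {s : ℕ} (hs : s < n) :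
    baseLevel n ℓ (s + 1) = 1 ∨
      (advisedLevel n ℓ s = max (ℓ s) (baseLevel n ℓ s) ∧
        advisedLevel n ℓ s = 1 + 2 * ((n : ℝ) - s) * baseLevel n ℓ s -
          (2 * ((n : ℝ) - s) - 1) * baseLevel n ℓ (s + 1)) := by
  refine (stepLevel_eq_one_or (x := baseLevel n ℓ s) (a := ℓ s) (one_le_of_lt hs)).imp id fun h => ?_
  have e : 1 + 2 * ((n : ℝ) - s) * baseLevel n ℓ s -
      (2 * ((n : ℝ) - s) - 1) * baseLevel n ℓ (s + 1) = max (ℓ s) (baseLevel n ℓ s) := by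
    rw [baseLevel]
    linarith
  have h1 : max (ℓ s) (baseLevel n ℓ s) ≤ 1 := max_le (hℓ s) (baseLevel_mem_Icc hℓ hs.le).2
  rw [advisedLevel, e]
  exact ⟨min_eq_right h1, min_eq_right h1⟩

/-- If water flowed back in step `s`, the common level is already 1, so the next advised vertex is
full. Otherwise both the target and the common level grow. -/
theorem advisedLevel_le_succ (hℓ : ∀ s, ℓ s ≤ 1) {s : ℕ} (hs : s + 1 < n)
    (hm : ℓ s ≤ ℓ (s + 1)) : advisedLevel n ℓ s ≤ advisedLevel n ℓ (s + 1) := by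
  have h := max_le_advisedLevel hℓ hs
  rcases advisedLevel_eq_or hℓ (by omega : s < n) with h1 | ⟨h1, -⟩
  · exact (advisedLevel_le_one s).trans (h1 ▸ (le_max_right _ _).trans h)
  · rw [h1]
    exact (max_le_max hm (baseLevel_le_succ hℓ (by omega))).trans h

theorem advisedLevel_mono (hℓ : ∀ s, ℓ s ≤ 1) (hm : ∀ i j, i ≤ j → j < n → ℓ i ≤ ℓ j) {i j : ℕ}
    (hij : i ≤ j) (hj : j < n) : advisedLevel n ℓ i ≤ advisedLevel n ℓ j := by
  induction j, hij using Nat.le_induction with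
  | base => exact le_rfl
  | succ j hij ih =>
    exact (ih (by omega)).trans (advisedLevel_le_succ hℓ hj (hm _ _ (by omega) hj))

/-- The starting step `t` is arbitrary so that the induction can peel off the first step. The
relation `t + r = n` makes the number of unadvised neighbours agree in both recursions. -/
theorem sum_baseLevel (t r : ℕ) (h : t + r = n) :
    ∑ s ∈ Finset.range r, baseLevel n ℓ (t + s + 1) =
      totalLevel ((List.range r).map fun s => ℓ (t + s)) (baseLevel n ℓ t) := by
  induction r generalizing t with
  | zero => simp [totalLevel]
  | succ r ih =>
    have ih' := ih (t + 1) (by omega)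
    have e : ∀ s, t + 1 + s = t + (s + 1) := fun s => by omega
    simp only [e] at ih'
    rw [List.range_succ_eq_map, List.map_cons, List.map_map, Finset.sum_range_succ', ih']
    have hm : 2 * ((n : ℝ) - t) - 1 = 2 * r + 1 := by
      rw [← h]; push_cast; ring
    simp only [totalLevel, Function.comp_def, List.length_map, List.length_range, add_zero,
      baseLevel, hm]
    rw [add_comm]

theorem plannedLevel_zero : plannedLevel n ℓ 0 = fun _ => 0 := by
  ext i
  simp [plannedLevel, baseLevel]

theorem plannedLevel_mem_Icc (hℓ : ∀ s, ℓ s ≤ 1) {s : ℕ} (hs : s ≤ n) (i : Fin (2 * n)) :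
    plannedLevel n ℓ s i ∈ Set.Icc (0 : ℝ) 1 := by
  unfold plannedLevel
  split_ifs with h
  · exact ⟨((baseLevel_mem_Icc hℓ (by omega)).1.trans (le_max_right _ _)).trans
      (max_le_advisedLevel hℓ (by omega)), advisedLevel_le_one _⟩
  · exact baseLevel_mem_Icc hℓ ((min_le_left _ _).trans hs)

theorem plannedLevel_succ_self {s : ℕ} (i : Fin (2 * n)) (hi : i.val = s) :
    plannedLevel n ℓ (s + 1) i = advisedLevel n ℓ s := by
  rw [plannedLevel, if_pos (by omega), hi]

/-- The non-strict bound `i.val + s ≤ 2 * n` also covers the vertex dropped just after the last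
step, which still has the common level. -/
theorem plannedLevel_of_present {s : ℕ} (i : Fin (2 * n)) (h1 : s ≤ i.val) (h2 : i.val + s ≤ 2 * n) :
    plannedLevel n ℓ s i = baseLevel n ℓ s := by
  rw [plannedLevel, if_neg (by omega), min_eq_left (by omega)]

theorem plannedLevel_succ_of_absent {s : ℕ} (hs : s < n) (i : Fin (2 * n))
    (h : i.val < s ∨ 2 * n ≤ i.val + s) :
    plannedLevel n ℓ (s + 1) i = plannedLevel n ℓ s i := by
  unfold plannedLevel
  by_cases hi : i.val < s
  · rw [if_pos (by omega), if_pos hi]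
  · rw [if_neg (by omega), if_neg hi, min_eq_right (by omega), min_eq_right (by omega)]

theorem commonArrival_refl_nbrs {s : ℕ} (hs : s < n) :
    (commonArrival n s (Equiv.refl _)).nbrs =
      insert ⟨s, by omega⟩ (commonBlock n s) := by
  ext j
  simp only [commonArrival, commonBlock, Equiv.coe_refl, Finset.image_id, Finset.mem_filter,
    Finset.mem_univ, true_and, Finset.mem_insert, Fin.ext_iff]
  omega

theorem card_commonBlock {s : ℕ} (hs : s < n) :
    ((commonBlock n s).card : ℝ) = 2 * ((n : ℝ) - s) - 1 := by
  have : (commonBlock n s).map Fin.valEmbedding = Finset.Ico (s + 1) (2 * n - s) := by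
    ext j
    simp only [Finset.mem_map, mem_commonBlock, Fin.valEmbedding_apply, Finset.mem_Ico]
    constructor
    · rintro ⟨i, hi, rfl⟩
      exact hi
    · intro h
      exact ⟨⟨j, by omega⟩, h, rfl⟩
  rw [← Finset.card_map Fin.valEmbedding, this, Nat.card_Ico, Nat.cast_sub (by omega),
    Nat.cast_sub (by omega)]
  push_cast
  ring

theorem sum_plannedLevel_sub {s : ℕ} (hs : s < n) :
    ∑ u ∈ (commonArrival n s (Equiv.refl _)).nbrs,
        (plannedLevel n ℓ (s + 1) u - plannedLevel n ℓ s u) =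
      advisedLevel n ℓ s - 2 * ((n : ℝ) - s) * baseLevel n ℓ s +
        (2 * ((n : ℝ) - s) - 1) * baseLevel n ℓ (s + 1) := by
  rw [commonArrival_refl_nbrs hs, Finset.sum_insert (by simp [commonBlock]),
    plannedLevel_succ_self (s := s) ⟨s, _⟩ rfl,
    plannedLevel_of_present (s := s) ⟨s, _⟩ le_rfl (by simp only; omega)]
  have : ∀ u ∈ commonBlock n s, plannedLevel n ℓ (s + 1) u - plannedLevel n ℓ s u =
      baseLevel n ℓ (s + 1) - baseLevel n ℓ s := by
    intro u hu
    rw [mem_commonBlock] at hu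
    rw [plannedLevel_of_present u (by omega) (by omega),
      plannedLevel_of_present u (by omega) (by omega)]
  rw [Finset.sum_congr rfl this, Finset.sum_const, nsmul_eq_mul, card_commonBlock hs]
  ring

theorem isGreedyResponse_plannedLevel (hℓ : ∀ s, ℓ s ≤ 1) {s : ℕ} (hs : s < n) :
    IsGreedyResponse (commonArrival n s (Equiv.refl _)) (plannedLevel n ℓ s)
      fun u => plannedLevel n ℓ (s + 1) u - plannedLevel n ℓ s u where
  nonneg u := by
    by_cases h : u.val < s ∨ 2 * n ≤ u.val + s
    · rw [plannedLevel_succ_of_absent hs u h, sub_self]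
    · rw [plannedLevel_of_present (s := s) u (by omega) (by omega), sub_nonneg]
      rcases eq_or_ne u.val s with h' | h'
      · rw [plannedLevel_succ_self u h']
        exact (le_max_right _ _).trans (max_le_advisedLevel hℓ hs)
      · rw [plannedLevel_of_present u (by omega) (by omega)]
        exact baseLevel_le_succ hℓ hs
  eq_zero u hu := by
    rw [commonArrival_refl_nbrs hs, Finset.mem_insert, mem_commonBlock, Fin.ext_iff] at hu
    rw [plannedLevel_succ_of_absent hs u (by simp only at hu; omega), sub_self]
  sum_le := by
    rw [sum_plannedLevel_sub hs]
    have : advisedLevel n ℓ s ≤ _ := min_le_right _ _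
    linarith
  add_le u := by
    rw [add_sub_cancel]
    exact (plannedLevel_mem_Icc hℓ (by omega) u).2
  greedy := by
    rw [sum_plannedLevel_sub hs]
    rcases min_choice 1 (1 + 2 * ((n : ℝ) - s) * baseLevel n ℓ s -
      (2 * ((n : ℝ) - s) - 1) * baseLevel n ℓ (s + 1)) with h | h
    -- The advised vertex is full. Either the others are full too, or the plan uses exactly one
    -- unit.
    · rcases advisedLevel_eq_or hℓ hs with h1 | ⟨-, h1⟩
      · right
        intro u hu
        rw [add_sub_cancel]
        rw [commonArrival_refl_nbrs hs, Finset.mem_insert, mem_commonBlock, Fin.ext_iff] at hu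
        rcases hu with hu | hu
        · rw [plannedLevel_succ_self u hu, advisedLevel, h]
        · rw [plannedLevel_of_present u hu.1 (by omega), h1]
      · left
        linarith
    · left
      rw [advisedLevel, h]
      ring

open Classical in
/-- The rule that follows the planned levels in the common phase, as long as the input is the one of
adversaries that do not reorder, and uses water-filling otherwise. -/
noncomputable def uniformRule (n : ℕ) (ℓ : ℕ → ℝ) (s : ℕ) (a : Arrival (Fin (2 * n)))
    (x : Fin (2 * n) → ℝ) : Fin (2 * n) → ℝ :=
  if s < n ∧ a = commonArrival n s (Equiv.refl _) ∧ x = plannedLevel n ℓ s then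
    fun u => plannedLevel n ℓ (s + 1) u - plannedLevel n ℓ s u
  else waterFill a.nbrs x

theorem isGreedyResponse_uniformRule (hℓ : ∀ s, ℓ s ≤ 1) (s : ℕ) (a : Arrival (Fin (2 * n)))
    (x : Fin (2 * n) → ℝ) (h0 : ∀ u, 0 ≤ x u) (h1 : ∀ u, x u ≤ 1) :
    IsGreedyResponse a x (uniformRule n ℓ s a x) := by
  unfold uniformRule
  split_ifs with h
  · obtain ⟨hs, rfl, rfl⟩ := h
    exact isGreedyResponse_plannedLevel hℓ hs
  · exact isGreedyResponse_waterFill a x h0 h1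

/-- The uniform algorithm with targets `ℓ` for the advised vertices. -/
noncomputable def uniformAlgorithm (n : ℕ) {ℓ : ℕ → ℝ} (hℓ : ∀ s, ℓ s ≤ 1) :
    FractionalAlgorithm (Fin (2 * n)) :=
  FractionalAlgorithm.ofRule (uniformRule n ℓ) (isGreedyResponse_uniformRule hℓ)

theorem greedy_uniformAlgorithm (hℓ : ∀ s, ℓ s ≤ 1) : (uniformAlgorithm n hℓ).Greedy :=
  FractionalAlgorithm.greedy_ofRule _

theorem uniformAlgorithm_push_common (hℓ : ∀ s, ℓ s ≤ 1) {past : List (Arrival (Fin (2 * n)))}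
    (hp : past.length < n)
    (hl : (uniformAlgorithm n hℓ).level past = plannedLevel n ℓ past.length) :
    (uniformAlgorithm n hℓ).push past (commonArrival n past.length (Equiv.refl _)) =
      fun u => plannedLevel n ℓ (past.length + 1) u - plannedLevel n ℓ past.length u := by
  have h : (uniformAlgorithm n hℓ).push past (commonArrival n past.length (Equiv.refl _)) =
      uniformRule n ℓ past.length (commonArrival n past.length (Equiv.refl _))
        ((uniformAlgorithm n hℓ).level past) := FractionalAlgorithm.push_ofRule _ _ _
  rw [h, hl, uniformRule, if_pos ⟨hp, rfl, rfl⟩]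

theorem uniformAlgorithm_push_later (hℓ : ∀ s, ℓ s ≤ 1) {past : List (Arrival (Fin (2 * n)))}
    (hp : n ≤ past.length) (a : Arrival (Fin (2 * n))) :
    (uniformAlgorithm n hℓ).push past a =
      waterFill a.nbrs ((uniformAlgorithm n hℓ).level past) := by
  have h : (uniformAlgorithm n hℓ).push past a = uniformRule n ℓ past.length a
      ((uniformAlgorithm n hℓ).level past) := FractionalAlgorithm.push_ofRule _ _ _
  rw [h, uniformRule, if_neg (by omega)]

/-! ### Runs of the uniform algorithm against the adversaries -/

variable (ρ : ReorderRule n)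

theorem commonState_uniformAlgorithm (hℓ : ∀ s, ℓ s ≤ 1) {s : ℕ} (hs : s ≤ n) :
    (commonState ρ (uniformAlgorithm n hℓ) s).order = Equiv.refl _ ∧
    (commonState ρ (uniformAlgorithm n hℓ) s).past.length = s ∧
    (uniformAlgorithm n hℓ).level (commonState ρ (uniformAlgorithm n hℓ) s).past =
      plannedLevel n ℓ s := by
  induction s with
  | zero =>
    refine ⟨rfl, rfl, ?_⟩
    rw [plannedLevel_zero]
    rfl
  | succ s ih =>
    obtain ⟨ho, hp, hl⟩ := ih (by omega)
    have hpush := uniformAlgorithm_push_common hℓ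
      (past := (commonState ρ (uniformAlgorithm n hℓ) s).past) (by omega) (by rw [hl, hp])
    rw [hp] at hpush
    have hl' : (uniformAlgorithm n hℓ).level
        (commonState ρ (uniformAlgorithm n hℓ) (s + 1)).past = plannedLevel n ℓ (s + 1) := by
      ext u
      simp only [commonState]
      rw [FractionalAlgorithm.level_cons, ho, hpush, hl]
      ring
    refine ⟨?_, by simp [commonState, hp], hl'⟩
    have h : (commonState ρ (uniformAlgorithm n hℓ) (s + 1)).order =
        ρ.reorder (commonState ρ (uniformAlgorithm n hℓ) (s + 1)).past
          (fun u => - (uniformAlgorithm n hℓ).level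
            (commonState ρ (uniformAlgorithm n hℓ) (s + 1)).past u)
          (commonBlock n s) (commonState ρ (uniformAlgorithm n hℓ) s).order := rfl
    rw [h, ho, hl']
    -- The sorting key is constant on the block, so no tie-breaking takes place.
    refine ρ.of_sorted _ _ _ _ fun i hi j hj _ => ?_
    rw [Finset.mem_coe, mem_commonBlock] at hi hj
    simp only [Equiv.refl_apply]
    rw [plannedLevel_of_present i hi.1 (by omega), plannedLevel_of_present j hj.1 (by omega)]

theorem uniformInCommonPhase_uniformAlgorithm (hℓ : ∀ s, ℓ s ≤ 1) :
    UniformInCommonPhase ρ (uniformAlgorithm n hℓ) := by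
  intro s hs S a u hu w hw hau haw
  obtain ⟨ho, hp, hl⟩ := commonState_uniformAlgorithm ρ hℓ hs.le
  have hpush := uniformAlgorithm_push_common hℓ
    (past := (commonState ρ (uniformAlgorithm n hℓ) s).past) (by omega) (by rw [hl, hp])
  rw [hp] at hpush
  have ha : a = commonArrival n s (Equiv.refl _) := by rw [← ho]
  have key : ∀ v ∈ a.nbrs, a.advice ≠ some v → (uniformAlgorithm n hℓ).push S.past a v =
      baseLevel n ℓ (s + 1) - baseLevel n ℓ s := by
    intro v hv hav
    have hvs : v ≠ ⟨s, by omega⟩ := by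
      rintro rfl
      apply hav
      rw [ha, commonArrival, dif_pos (by omega)]
      rfl
    rw [ha, commonArrival_refl_nbrs hs, Finset.mem_insert, mem_commonBlock] at hv
    have hv' := hv.resolve_left hvs
    rw [ha, hpush]
    simp only
    rw [plannedLevel_of_present v hv'.1 (by omega), plannedLevel_of_present v (by omega) (by omega)]
  rw [key u hu hau, key w hw haw]

theorem commonState_levels_uniformAlgorithm (hℓ : ∀ s, ℓ s ≤ 1) {i : ℕ} (hi : i < n) :
    (commonState ρ (uniformAlgorithm n hℓ) n).levels (uniformAlgorithm n hℓ) i =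
      advisedLevel n ℓ i := by
  obtain ⟨ho, -, hl⟩ := commonState_uniformAlgorithm ρ hℓ (le_refl n)
  rw [AdversaryState.levels, ho, hl, profile, dif_pos (by omega)]
  simp [plannedLevel, hi]

theorem sum_unadvised_uniformAlgorithm (hℓ : ∀ s, ℓ s ≤ 1) :
    ∑ i ∈ Finset.Ico n (2 * n),
        (commonState ρ (uniformAlgorithm n hℓ) n).levels (uniformAlgorithm n hℓ) i =
      totalLevel ((List.range n).map ℓ) 0 := by
  obtain ⟨ho, -, hl⟩ := commonState_uniformAlgorithm ρ hℓ (le_refl n)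
  have h := sum_baseLevel (n := n) (ℓ := ℓ) 0 n (by omega)
  simp only [zero_add] at h
  change _ = totalLevel _ (baseLevel n ℓ 0)
  rw [← h, Finset.sum_Ico_eq_sum_range, ← Finset.sum_range_reflect]
  refine Finset.sum_congr (by congr 1; omega) fun s hs => ?_
  have hs' := Finset.mem_range.1 hs
  rw [AdversaryState.levels, ho, hl, profile, dif_pos (by omega)]
  rw [Equiv.refl_apply, plannedLevel, if_neg (by simp only; omega)]
  congr 1
  simp only
  omega

/-- The run of the uniform algorithm in the robustness phase: no reordering has taken place, and
the levels of the vertices that are still present are nondecreasing. -/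
structure IsMonotoneRobustState (M : FractionalAlgorithm (Fin (2 * n))) (k : ℕ) : Prop where
  order_eq : (robustState ρ M k).order = Equiv.refl _
  le_length : n ≤ (robustState ρ M k).past.length
  mono : ∀ i j, k ≤ i → i ≤ j → j < n →
    (robustState ρ M k).levels M i ≤ (robustState ρ M k).levels M j

theorem robustState_zero_order_uniformAlgorithm (hℓ : ∀ s, ℓ s ≤ 1)
    (hm : ∀ i j, i ≤ j → j < n → ℓ i ≤ ℓ j) :
    (robustState ρ (uniformAlgorithm n hℓ) 0).order = Equiv.refl _ := by
  obtain ⟨ho, hp, hl⟩ := commonState_uniformAlgorithm ρ hℓ (le_refl n)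
  simp only [robustState]
  rw [ho, hl]
  refine ρ.of_sorted _ _ _ _ fun i hi j hj hij => ?_
  rw [Finset.mem_coe, mem_robustBlock] at hi hj
  simp only [Equiv.refl_apply]
  rw [plannedLevel, plannedLevel, if_pos hi.2, if_pos hj.2]
  exact advisedLevel_mono hℓ hm hij hj.2

theorem isMonotoneRobustState_zero (hℓ : ∀ s, ℓ s ≤ 1)
    (hm : ∀ i j, i ≤ j → j < n → ℓ i ≤ ℓ j) :
    IsMonotoneRobustState ρ (uniformAlgorithm n hℓ) 0 where
  order_eq := robustState_zero_order_uniformAlgorithm ρ hℓ hm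
  le_length := (commonState_uniformAlgorithm ρ hℓ (le_refl n)).2.1.ge
  mono _ _ _ hij hj := robustState_levels_zero_mono ρ _ hij hj

theorem robustArrival_refl_nbrs (k : ℕ) :
    (robustArrival n k (Equiv.refl _)).nbrs = robustBlock n k := by
  simp [robustArrival, robustBlock]

theorem sum_robustBlock (k : ℕ) (f : ℕ → ℝ) :
    ∑ u ∈ robustBlock n k, f u = ∑ i ∈ Finset.Ico k n, f i := by
  have : (robustBlock n k).map Fin.valEmbedding = Finset.Ico k n := by
    ext j
    simp only [Finset.mem_map, mem_robustBlock, Fin.valEmbedding_apply, Finset.mem_Ico]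
    constructor
    · rintro ⟨i, hi, rfl⟩
      exact hi
    · intro h
      exact ⟨⟨j, by omega⟩, h, rfl⟩
  rw [← this, Finset.sum_map]
  rfl

/-- Water-filling replaces each present level by its maximum with `h`, a monotone operation, so
levels in nondecreasing order stay so. The properties of `h` are those needed to compare prefix
sums. -/
theorem IsMonotoneRobustState.exists_waterLevel {hℓ : ∀ s, ℓ s ≤ 1} {k : ℕ}
    (hM : IsMonotoneRobustState ρ (uniformAlgorithm n hℓ) k) :
    (robustState ρ (uniformAlgorithm n hℓ) (k + 1)).order = Equiv.refl _ ∧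
    ∃ h : ℝ,
      (∀ i, k ≤ i → i < n →
        (robustState ρ (uniformAlgorithm n hℓ) (k + 1)).levels (uniformAlgorithm n hℓ) i =
          max h ((robustState ρ (uniformAlgorithm n hℓ) k).levels (uniformAlgorithm n hℓ) i)) ∧
      (∑ i ∈ Finset.Ico k n,
        max (h - (robustState ρ (uniformAlgorithm n hℓ) k).levels (uniformAlgorithm n hℓ) i) 0 = 1 ∨
          h = 1) := by
  set M := uniformAlgorithm n hℓ with hMdef
  set S := robustState ρ M k with hS
  set h := waterLevel (robustBlock n k) (M.level S.past) with hh
  have hlev : ∀ u : Fin (2 * n), S.levels M u = M.level S.past u := by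
    intro u
    rw [AdversaryState.levels, profile_val, hM.order_eq]
    rfl
  have hnew : ∀ u ∈ robustBlock n k,
      M.level (robustState ρ M (k + 1)).past u = max h (M.level S.past u) := by
    intro u hu
    simp only [robustState]
    rw [FractionalAlgorithm.level_cons, ← hS, hM.order_eq,
      uniformAlgorithm_push_later hℓ hM.le_length, robustArrival_refl_nbrs]
    exact add_waterFill_of_mem hu _
  have horder : (robustState ρ M (k + 1)).order = Equiv.refl _ := by
    have e : (robustState ρ M (k + 1)).order =
      ρ.reorder (robustState ρ M (k + 1)).past
        (fun u => M.level (robustState ρ M (k + 1)).past u) (robustBlock n k) S.order := rfl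
    rw [e, hM.order_eq]
    refine ρ.of_sorted _ _ _ _ fun i hi j hj hij => ?_
    simp only [Equiv.refl_apply]
    rw [hnew i hi, hnew j hj, ← hlev, ← hlev]
    rw [Finset.mem_coe, mem_robustBlock] at hi hj
    exact max_le_max_left _ (hM.mono _ _ hi.1 hij hj.2)
  refine ⟨horder, h, fun i hki hin => ?_, ?_⟩
  · have hi2 : i < 2 * n := by omega
    have h1 := hnew ⟨i, hi2⟩ ((mem_robustBlock k _).2 ⟨hki, hin⟩)
    have h2 := hlev ⟨i, hi2⟩
    simp only at h2
    rw [h2, ← h1, AdversaryState.levels, horder, profile, dif_pos hi2]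
    rfl
  · have hw := (isWaterLevel_waterLevel (robustBlock n k) (M.level S.past) (M.level_nonneg _)).2.2
    rw [← sum_robustBlock k fun i => max (h - S.levels M i) 0]
    simp only [hlev]
    exact hw

theorem IsMonotoneRobustState.succ {hℓ : ∀ s, ℓ s ≤ 1} {k : ℕ}
    (hM : IsMonotoneRobustState ρ (uniformAlgorithm n hℓ) k) :
    IsMonotoneRobustState ρ (uniformAlgorithm n hℓ) (k + 1) where
  order_eq := (hM.exists_waterLevel ρ).1
  le_length := hM.le_length.trans (by simp [robustState])
  mono _ _ hi hij hj := robustState_levels_succ_mono ρ _ k (by omega) hij hj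

theorem isMonotoneRobustState (hℓ : ∀ s, ℓ s ≤ 1)
    (hm : ∀ i j, i ≤ j → j < n → ℓ i ≤ ℓ j) (k : ℕ) :
    IsMonotoneRobustState ρ (uniformAlgorithm n hℓ) k := by
  induction k with
  | zero => exact isMonotoneRobustState_zero ρ hℓ hm
  | succ k ih => exact ih.succ ρ

theorem neverReorders_uniformAlgorithm (hℓ : ∀ s, ℓ s ≤ 1)
    (hm : ∀ i j, i ≤ j → j < n → ℓ i ≤ ℓ j) : NeverReorders ρ (uniformAlgorithm n hℓ) := by
  refine ⟨fun s hs => ?_, ?_, fun k _ => ?_⟩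
  · rw [(commonState_uniformAlgorithm ρ hℓ hs).1, (commonState_uniformAlgorithm ρ hℓ hs.le).1]
  · rw [(isMonotoneRobustState ρ hℓ hm 0).order_eq,
      (commonState_uniformAlgorithm ρ hℓ le_rfl).1]
  · rw [(isMonotoneRobustState ρ hℓ hm (k + 1)).order_eq,
      (isMonotoneRobustState ρ hℓ hm k).order_eq]

end UniformPlan

/-! ### Comparison of the values -/

/-- Water-filling keeps the prefix sums of the levels above those of any other response after which
the vertices are sorted by level. -/
theorem sum_range_le_of_waterFill {n k : ℕ} {w w' q q' : ℕ → ℝ} {h c : ℝ} (hk : k ≤ n)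
    (hle : ∀ j ≤ n, ∑ i ∈ Finset.range j, q i ≤ c + ∑ i ∈ Finset.range j, w i)
    (hw : ∀ i, k ≤ i → i < n → w' i = max h (w i)) (hw' : ∀ i < k, w' i = w i)
    (hwm : ∀ i j, k ≤ i → i ≤ j → j < n → w i ≤ w j)
    (hfill : ∑ i ∈ Finset.Ico k n, max (h - w i) 0 = 1 ∨ h = 1)
    (hq : ∀ j, ∑ i ∈ Finset.range j, q' i ≤ ∑ i ∈ Finset.range j, q i + 1)
    (hq' : ∀ i < k, q' i = q i) (hqm : ∀ i j, k ≤ i → i ≤ j → j < n → q' i ≤ q' j)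
    (hq1 : ∀ i, q' i ≤ 1) :
    ∀ j ≤ n, ∑ i ∈ Finset.range j, q' i ≤ c + ∑ i ∈ Finset.range j, w' i := by
  have hlow : ∀ j ≤ k, ∑ i ∈ Finset.range j, q' i ≤ c + ∑ i ∈ Finset.range j, w' i := by
    intro j hj
    rw [Finset.sum_congr rfl fun i hi => hq' i ((Finset.mem_range.1 hi).trans_le hj),
      Finset.sum_congr rfl fun i hi => hw' i ((Finset.mem_range.1 hi).trans_le hj)]
    exact hle j (hj.trans hk)
  have hflat : ∀ j ≤ n, k ≤ j → (∀ i, k ≤ i → i < j → q' i ≤ h) →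
      ∑ i ∈ Finset.range j, q' i ≤ c + ∑ i ∈ Finset.range j, w' i := by
    intro j hj hkj hqh
    rw [← Finset.sum_range_add_sum_Ico _ hkj, ← Finset.sum_range_add_sum_Ico _ hkj, ← add_assoc]
    refine add_le_add (hlow k le_rfl) (Finset.sum_le_sum fun i hi => ?_)
    obtain ⟨h1, h2⟩ := Finset.mem_Ico.1 hi
    rw [hw i h1 (by omega)]
    exact (hqh i h1 h2).trans (le_max_left _ _)
  rcases hfill with hfill | rfl
  swap
  · intro j hj
    rcases le_total j k with hjk | hkj
    · exact hlow j hjk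
    · exact hflat j hj hkj fun i _ _ => hq1 i
  -- If all the water lands before `j`, this prefix gains a full unit, the most that the competitor
  -- can gain.
  have hgain : ∀ j ≤ n, k ≤ j → (∀ i, j ≤ i → i < n → h ≤ w i) →
      ∑ i ∈ Finset.range j, q' i ≤ c + ∑ i ∈ Finset.range j, w' i := by
    intro j hj hkj hh
    have h1 : ∑ i ∈ Finset.Ico k j, max (h - w i) 0 = 1 := by
      rw [← hfill, ← Finset.sum_Ico_consecutive _ hkj hj, left_eq_add]
      refine Finset.sum_eq_zero fun i hi => max_eq_right ?_
      obtain ⟨h1, h2⟩ := Finset.mem_Ico.1 hi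
      linarith [hh i h1 h2]
    have h2 : ∑ i ∈ Finset.Ico k j, w' i = ∑ i ∈ Finset.Ico k j, w i + 1 := by
      rw [← h1, ← Finset.sum_add_distrib]
      refine Finset.sum_congr rfl fun i hi => ?_
      obtain ⟨h1, h2⟩ := Finset.mem_Ico.1 hi
      rw [hw i h1 (by omega), ← max_add_add_left]
      simp
    have h3 : ∑ i ∈ Finset.range j, w' i = ∑ i ∈ Finset.range j, w i + 1 := by
      rw [← Finset.sum_range_add_sum_Ico _ hkj, ← Finset.sum_range_add_sum_Ico _ hkj, h2,
        Finset.sum_congr rfl fun i hi => hw' i (Finset.mem_range.1 hi), add_assoc]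
    linarith [hq j, hle j hj]
  intro j hj
  rcases le_total j k with hjk | hkj
  · exact hlow j hjk
  obtain ⟨d, hd⟩ := Nat.exists_eq_add_of_le hj
  induction d generalizing j with
  | zero => exact hgain j hj hkj fun i h1 h2 => by omega
  -- Downward induction on `j`. If neither case above applies, then `w' j = h < q' j`, and the claim
  -- for `j` follows from that for `j + 1` by subtracting these terms.
  | succ d ih =>
    rcases le_or_gt h (w j) with hwj | hwj
    · exact hgain j hj hkj fun i h1 h2 => hwj.trans (hwm j i hkj h1 h2)
    rcases le_or_gt (q' j) h with hqj | hqj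
    · exact hflat j hj hkj fun i h1 h2 => (hqm i j h1 h2.le (by omega)).trans hqj
    · have := ih (j + 1) (by omega) (by omega) (by omega)
      rw [Finset.sum_range_succ, Finset.sum_range_succ, hw j hkj (by omega),
        max_eq_left hwj.le] at this
      linarith

theorem robustValue_le_uniformAlgorithm {n : ℕ} (ρ : ReorderRule n)
    (M : FractionalAlgorithm (Fin (2 * n))) :
    robustValue ρ M ≤ robustValue ρ (uniformAlgorithm n
      (AdversaryState.levels_le_one M (robustState ρ M 0))) := by
  have hℓ := AdversaryState.levels_le_one M (robustState ρ M 0)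
  have hm : ∀ i j, i ≤ j → j < n →
      (robustState ρ M 0).levels M i ≤ (robustState ρ M 0).levels M j :=
    fun i j hij hj => robustState_levels_zero_mono ρ M hij hj
  set M' := uniformAlgorithm n hℓ with hM'
  have hc : ∑ i ∈ Finset.Ico n (2 * n), (commonState ρ M n).levels M i ≤
      ∑ i ∈ Finset.Ico n (2 * n), (commonState ρ M' n).levels M' i := by
    rw [sum_unadvised_uniformAlgorithm]
    refine (sum_unadvised_le_totalLevel ρ M).trans (totalLevel_le_of_perm_of_sorted le_rfl
      zero_le_one ?_ (perm_robustState_levels_zero ρ M) ?_)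
    · intro x hx
      obtain ⟨i, -, rfl⟩ := List.mem_map.1 hx
      exact AdversaryState.levels_le_one M _ i
    · rw [List.pairwise_map]
      exact List.pairwise_lt_range.imp_of_mem fun _ hj hij =>
        hm _ _ hij.le (List.mem_range.1 hj)
  -- The levels at the indices from `n` on are frozen in the robustness phase, so this surplus
  -- remains available to the end.
  set c := ∑ i ∈ Finset.Ico n (2 * n), (commonState ρ M' n).levels M' i -
    ∑ i ∈ Finset.Ico n (2 * n), (commonState ρ M n).levels M i with hcdef
  have key : ∀ k ≤ n, ∀ j ≤ n, ∑ i ∈ Finset.range j, (robustState ρ M k).levels M i ≤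
      c + ∑ i ∈ Finset.range j, (robustState ρ M' k).levels M' i := by
    intro k hk
    induction k with
    | zero =>
      intro j hj
      refine (Finset.sum_le_sum fun i hi => ?_).trans (le_add_of_nonneg_left (by linarith))
      have hi' : i < n := (Finset.mem_range.1 hi).trans_le hj
      have e : (robustState ρ M' 0).levels M' = (commonState ρ M' n).levels M' := by
        rw [AdversaryState.levels, AdversaryState.levels,
          (neverReorders_uniformAlgorithm ρ hℓ hm).2.1]
        rfl
      rw [e, commonState_levels_uniformAlgorithm ρ hℓ hi']
      exact (le_max_left _ _).trans (max_le_advisedLevel hℓ hi')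
    | succ k ih =>
      have hS := isMonotoneRobustState ρ hℓ hm k
      obtain ⟨-, h, hw, hfill⟩ := hS.exists_waterLevel ρ
      exact sum_range_le_of_waterFill (by omega) (ih (by omega)) hw
        (fun i hi => robustState_levels_succ ρ M' k (Or.inl hi)) hS.mono hfill
        (sum_robustState_levels_succ_le ρ M k)
        (fun i hi => robustState_levels_succ ρ M k (Or.inl hi))
        (fun i j hi hij hj => robustState_levels_succ_mono ρ M k hi hij hj)
        (AdversaryState.levels_le_one M _)
  rw [robustValue_eq, robustValue_eq]
  linarith [key n le_rfl n le_rfl]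

theorem consistencyValue_le_uniformAlgorithm {n : ℕ} (ρ : ReorderRule n)
    (M : FractionalAlgorithm (Fin (2 * n))) :
    consistencyValue ρ M ≤ consistencyValue ρ (uniformAlgorithm n
      (AdversaryState.levels_le_one M (robustState ρ M 0))) := by
  have hℓ := AdversaryState.levels_le_one M (robustState ρ M 0)
  rw [(greedy_uniformAlgorithm hℓ).consistencyValue_eq]
  refine (consistencyValue_le ρ M).trans (add_le_add_left ?_ _)
  rw [← sum_robustState_levels_zero]
  refine Finset.sum_le_sum fun i hi => ?_
  rw [commonState_levels_uniformAlgorithm ρ hℓ (Finset.mem_range.1 hi)]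
  exact (le_max_left _ _).trans (max_le_advisedLevel hℓ (Finset.mem_range.1 hi))

theorem mainTheorem4 (n : ℕ) (hn : 1 ≤ n) (ρ : ReorderRule n)
    (M : FractionalAlgorithm (Fin (2 * n))) :
    ∃ M' : FractionalAlgorithm (Fin (2 * n)),
      M'.Greedy ∧ NeverReorders ρ M' ∧ UniformInCommonPhase ρ M' ∧
      robustValue ρ M ≤ robustValue ρ M' ∧
      consistencyValue ρ M ≤ consistencyValue ρ M' :=
  -- The targets are the levels of `M` just after the sorting that opens the robustness phase; only
  -- those with index below `n` matter.
  have hℓ := AdversaryState.levels_le_one M (robustState ρ M 0)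
  ⟨uniformAlgorithm n hℓ, greedy_uniformAlgorithm hℓ,
    neverReorders_uniformAlgorithm ρ hℓ fun _ _ hij hj => robustState_levels_zero_mono ρ M hij hj,
    uniformInCommonPhase_uniformAlgorithm ρ hℓ, robustValue_le_uniformAlgorithm ρ M,
    consistencyValue_le_uniformAlgorithm ρ M⟩
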